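/- Fix a universe $\mathcal U$ of sets. A *signature* $\Sigma=(S,\Sigma)$ is a set $S$ of sorts with sets $\Sigma_{w,s}$ of operations, for $w\in S^\ast$, $s\in S$. For a word $w$ let ${\downarrow}w$ be the $S$-sorted set of its positions (the position $i$ has sort $w_i$), let $T_\Sigma(X)$ be the $S$-sorted set of $\Sigma$-terms over an $S$-sorted set $X$, and write $A_w=\prod_i A_{w_i}=\mathrm{Hom}({\downarrow}w,A)$. For a mapping $\varphi:S\to T^\ast$ let $\varphi^\sharp:S^\ast\to T^\ast$ be its extension by concatenation. A *polyderivor* $\mathbf d=(\varphi,d):\Sigma\to\Lambda=(T,\Lambda)$ consists of $\varphi:S\to T^\ast$ and mappings $d:\Sigma_{w,s}\to T_\Lambda({\downarrow}\varphi^\sharp(w))_{\varphi(s)}$. It turns every $\Lambda$-algebra $\mathbf B$ into a derived $\Sigma$-algebra $\mathbf d^\ast\mathbf B$ on $(B_{\varphi(s)})_{s\in S}$, and it induces translations $d^\sharp:T_\Sigma({\downarrow}w)_s\to T_\Lambda({\downarrow}\varphi^\sharp(w))_{\varphi(s)}$. The composite of $\mathbf d$ with $\mathbf e=(\psi,e)$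 is $(\psi^\sharp\circ\varphi,\,e^\sharp\circ d)$; the identity has $\varphi(s)=(s)$. A *transformation* $\xi:\mathbf d\rightsquigarrow\mathbf d'$ between polyderivors $\Sigma\to\Lambda$ is a family $\xi_s\in T_\Lambda({\downarrow}\varphi(s))_{\varphi'(s)}$ $(s\in S)$ with $\xi_s\circ d(\sigma)=d'(\sigma)\circ\xi_w$ for all $\sigma\in\Sigma_{w,s}$, where $\circ$ is substitution and $\xi_w$ is the juxtaposition of the $\xi_{w_i}$. With vertical composition $(\chi_s\circ\xi_s)_s$ and horizontal composition $(\chi_{\psi(s)}\circ h^\sharp(\xi_s))_s$, for $\xi:\mathbf d\rightsquigarrow(\psi,e)$ from $\Sigma$ to $\Lambda$ and $\chi:\mathbf h\rightsquigarrow\mathbf h'$ from $\Lambda$ to $\Omega$, this gives the 2-category $\mathbf{Sig}_{\mathfrak{pd}}$. An *adjoint square* from $F\dashv G$ to $F'\dashv G'$ with top $J$ and bottom $H$ is a quadruple of natural transformations $\lambda_0:F'J\Rightarrow HF$, $\lambda_1:J\Rightarrow G'HF$, $\lambda_2:F'JG\Rightarrow H$, $\lambda_3:JG\Rightarrow G'H$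 that correspond to one another under the adjunctions (so that $\lambda_0$ determines the others). The 2-category $\mathbf{Mnd}_{\mathbf V,\mathrm{alg}}$ has as objects the monads $(\mathbf C,\mathbb T)$ on categories $\mathbf C$ whose hom-sets lie in $\mathcal U$ and whose set of objects lies in the next universe. A morphism $(\mathbf C,\mathbb T)\to(\mathbf C',\mathbb T')$ is an *alg-morphism*: an adjunction $J\dashv K$ from $\mathbf C$ to $\mathbf C'$ and an adjoint square $\lambda$ from $J\dashv K$ to $J\dashv K$ with top $T$ and bottom $T'$ such that $\lambda_0\cdot J\eta=\eta'J$ and $\lambda_0\cdot J\mu=\mu'J\cdot T'\lambda_0\cdot\lambda_0T$. A 2-cell $(J\dashv K,\lambda)\Rightarrow(J'\dashv K',\lambda')$ is an *alg-transformation*: an adjoint square $\xi$ from $J\dashv K$ to $J'\dashv K'$ with top $1$ and bottom $T'$ such that $\mu'J\cdot T'\lambda_0\cdot\xi_0T=\mu'J\cdot T'\xi_0\cdot\lambda'_0$. Morphisms compose by composing adjunctions and pasting squares ($0$-component $\lambda'_0F\cdot L'\lambda_0$ for $F$ followed by $L'$); the vertical composite of $\xi$ and $\xi'$ has $0$-component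 $\mu'J\cdot T'\xi_0\cdot\xi'_0$ and identities have $0$-component $\eta'J$; the horizontal composite of $\xi:(J_1,\lambda_1)\Rightarrow(J_2,\lambda_2)$ with a morphism $(L,\rho)$ after it has $0$-component $\rho_0J_1\cdot L\xi_0$, and of $\xi'$ with a morphism $(J,\lambda)$ before it has $0$-component $\xi'_0J$. **Corollary 20.** There is an embedding of the 2-category $\mathbf{Sig}_{\mathfrak{pd}}$ into the 2-category $\mathbf{Mnd}_{\mathbf V,\mathrm{alg}}$, that is, a pseudo-functor $\mathbb T$ with the following properties. 1. On objects, $\mathbb T$ sends a signature $\Sigma$ to $(\mathbf{Set}^S,\mathbb T_\Sigma)$, where $\mathbb T_\Sigma$ is the monad of the adjunction $\mathbf T_\Sigma\dashv\mathrm G_\Sigma$ between $\mathbf{Set}^S$ and $\mathbf{Alg}(\Sigma)$ (free algebra, underlying sorted set). 2. On morphisms, $\mathbb T$ sends a polyderivor $\mathbf d=(\varphi,d)$ to the alg-morphism $\mathbb T_{\mathbf d}=(\coprod^\dagger_\varphi\dashv\Delta^\natural_\varphi,\lambda)$, where $(\Delta^\natural_\varphi B)_s=B_{\varphi(s)}$,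 where $(\coprod^\dagger_\varphi A)_t$ is the set of all $(a,s,j)$ with $a\in A_s$ and $j$ a position of $\varphi(s)$ of sort $t$, and where $\lambda_1$ at $X$ is the homomorphism $\mathbf T_\Sigma(X)\to\mathbf d^\ast(\mathbf T_\Lambda(\coprod^\dagger_\varphi X))$ that extends $X\to\Delta^\natural_\varphi\coprod^\dagger_\varphi X\to\Delta^\natural_\varphi T_\Lambda(\coprod^\dagger_\varphi X)$, the composite of the unit of $\coprod^\dagger_\varphi\dashv\Delta^\natural_\varphi$ with the insertion of variables. 3. On 2-cells, $\mathbb T$ sends a transformation $\xi:\mathbf d\rightsquigarrow\mathbf d'$ to the alg-transformation $\mathbb T_\xi:\mathbb T_{\mathbf d}\Rightarrow\mathbb T_{\mathbf d'}$ whose $0$-component at $X$ sends $(x,s,i)\in\coprod^\dagger_{\varphi'}X$ to the term $(\xi_s)_i$ with every variable $j\in{\downarrow}\varphi(s)$ replaced by $(x,s,j)$. 4. $\mathbb T$ is an embedding: $\xi\mapsto\mathbb T_\xi$ is a bijection from the transformations $\mathbf d\rightsquigarrow\mathbf d'$ onto the alg-transformations $\mathbb T_{\mathbf d}\Rightarrow\mathbb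 T_{\mathbf d'}$; polyderivors $\mathbf d,\mathbf d'$ with $\mathbb T_{\mathbf d}\cong\mathbb T_{\mathbf d'}$ are isomorphic; and signatures $\Sigma,\Lambda$ whose monads $(\mathbf{Set}^S,\mathbb T_\Sigma)$, $(\mathbf{Set}^T,\mathbb T_\Lambda)$ are equivalent in $\mathbf{Mnd}_{\mathbf V,\mathrm{alg}}$ are equivalent in $\mathbf{Sig}_{\mathfrak{pd}}$. -/

import Mathlib

open CategoryTheory

universe u

/-- A many-sorted signature: a set of sorts together with, for every word of sorts `w` and sort
`s`, a set `Op w s` of formal operations of arity `w` and coarity `s`. -/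
structure Signature : Type (u + 1) where
  /-- The sorts. -/
  Srt : Type u
  /-- The formal operations with given arity and coarity. -/
  Op : List Srt → Srt → Type u

/-- `Var w t` is the component at the sort `t` of the sorted set of variables of the word `w`:
there is one variable of sort `t` for every position of `w` at which `t` stands. -/
inductive Var {T : Type u} : List T → T → Type u
  | here {t : T} {w : List T} : Var (t :: w) t
  | there {t t' : T} {w : List T} (v : Var w t) : Var (t' :: w) t

/-- `Tuple X w` is the set of families in `X` with index word `w`, that is, the set of sorted maps
from the variables of `w` to `X`; this is the product of the `X t` over the positions of `w`. -/
abbrev Tuple {T : Type u} (X : T → Type u) (w : List T) : Type u :=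
  ∀ t, Var w t → X t

namespace Var

variable {S T : Type u}

/-- The position in the word of a variable. -/
def pos : {w : List T} → {t : T} → Var w t → Fin w.length
  | _, _, here => ⟨0, Nat.succ_pos _⟩
  | _, _, there v => Fin.succ v.pos

theorem get_pos : {w : List T} → {t : T} → (v : Var w t) → w.get v.pos = t
  | _, _, here => rfl
  | _, _, there v => get_pos v

/-- The variable at a position of a word. -/
def ofPos : (w : List T) → (i : Fin w.length) → Var w (w.get i)
  | [], i => i.elim0
  | _ :: _, ⟨0, _⟩ => here
  | _ :: w, ⟨i + 1, h⟩ => there (ofPos w ⟨i, Nat.lt_of_succ_lt_succ h⟩)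

theorem pos_ofPos : (w : List T) → (i : Fin w.length) → (ofPos w i).pos = i
  | [], i => i.elim0
  | _ :: _, ⟨0, _⟩ => rfl
  | _ :: w, ⟨i + 1, h⟩ => congrArg Fin.succ (pos_ofPos w ⟨i, Nat.lt_of_succ_lt_succ h⟩)

theorem pos_injective : {w : List T} → {t : T} → Function.Injective (pos : Var w t → _)
  | _, _, here, here, _ => rfl
  | _, _, here, there _, h => absurd h.symm (Fin.succ_ne_zero _)
  | _, _, there _, here, h => absurd h (Fin.succ_ne_zero _)
  | _, _, there _, there _, h => congrArg there (pos_injective (Fin.succ_injective _ h))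

/-- The variables of sort `t` of a word are the positions of the word at which `t` stands. -/
def equivPos (w : List T) (t : T) : Var w t ≃ {i : Fin w.length // w.get i = t} where
  toFun v := ⟨v.pos, v.get_pos⟩
  invFun i := i.2 ▸ ofPos w i.1
  left_inv v := by
    apply pos_injective
    have key : ∀ (t' : T) (h : w.get v.pos = t'), (h ▸ ofPos w v.pos : Var w t').pos = v.pos := by
      intro t' h
      subst h
      exact pos_ofPos w _
    exact key t v.get_pos
  right_inv := by
    rintro ⟨i, rfl⟩
    exact Subtype.ext (pos_ofPos w i)

/-- A variable of the left factor, as a variable of the concatenation. -/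
def inl : {a : List T} → {t : T} → Var a t → (b : List T) → Var (a ++ b) t
  | _, _, here, _ => here
  | _, _, there v, b => there (inl v b)

/-- A variable of the right factor, as a variable of the concatenation. -/
def inr : (a : List T) → {b : List T} → {t : T} → Var b t → Var (a ++ b) t
  | [], _, _, v => v
  | _ :: a, _, _, v => there (inr a v)

/-- Every variable of a concatenation belongs to one of the two factors. -/
def cases : (a : List T) → {b : List T} → {t : T} → Var (a ++ b) t → Var a t ⊕ Var b t
  | [], _, _, v => Sum.inr v
  | _ :: _, _, _, here => Sum.inl here
  | _ :: a, _, _, there v => (cases a v).map there id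

theorem cases_inl : {a : List T} → {t : T} → (v : Var a t) → (b : List T) →
    cases a (inl v b) = Sum.inl v
  | _, _, here, _ => rfl
  | _, _, there v, b => by
    rw [inl, cases, cases_inl v b]; rfl

theorem cases_inr : (a : List T) → {b : List T} → {t : T} → (v : Var b t) →
    cases a (inr a v) = Sum.inr v
  | [], _, _, _ => rfl
  | _ :: a, _, _, v => by
    rw [inr, cases, cases_inr a v]; rfl

theorem elim_cases : (a : List T) → {b : List T} → {t : T} → (v : Var (a ++ b) t) →
    Sum.elim (fun x => inl x b) (fun y => inr a y) (cases a v) = v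
  | [], _, _, _ => rfl
  | _ :: _, _, _, here => rfl
  | _ :: a, b, _, there v => by
    have ih := elim_cases a v
    rw [cases]
    cases h : cases a v with
    | inl x => rw [h] at ih; exact congrArg there ih
    | inr y => rw [h] at ih; exact congrArg there ih

variable (φ : S → List T)

/-- The variable `b` of the word `φ s` that has been substituted for the variable `a` of sort `s`
of the word `w`. -/
def pair : {w : List S} → {s : S} → {t : T} → Var w s → Var (φ s) t → Var (w.flatMap φ) t
  | _ :: w, _, _, here, b => inl b (w.flatMap φ)
  | s' :: _, _, _, there a, b => inr (φ s') (pair a b)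

/-- The variable of `w` and the variable of its image under `φ` from which a variable of the
word `w.flatMap φ` arises. -/
def split : (w : List S) → {t : T} → Var (w.flatMap φ) t → Σ s, Var w s × Var (φ s) t
  | [], _, v => nomatch (v : Var ([] : List T) _)
  | s :: w, _, v =>
    match cases (φ s) (b := w.flatMap φ) v with
    | Sum.inl b => ⟨s, here, b⟩
    | Sum.inr v' => ⟨(split w v').1, there (split w v').2.1, (split w v').2.2⟩

variable {φ}

@[simp]
theorem split_pair : {w : List S} → {s : S} → {t : T} → (a : Var w s) → (b : Var (φ s) t) →
    split φ w (pair φ a b) = ⟨s, a, b⟩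
  | _ :: w, _, _, here, b => by
    rw [split, pair, cases_inl]
  | s' :: _, _, _, there a, b => by
    rw [split, pair, cases_inr]
    dsimp only
    rw [split_pair a b]

theorem pair_split : (w : List S) → {t : T} → (v : Var (w.flatMap φ) t) →
    pair φ (split φ w v).2.1 (split φ w v).2.2 = v
  | [], _, v => nomatch (v : Var ([] : List T) _)
  | s :: w, _, v => by
    have h := elim_cases (φ s) (b := w.flatMap φ) v
    rw [split]
    cases h' : cases (φ s) (b := w.flatMap φ) v with
    | inl b => rw [h'] at h; exact h
    | inr v' =>
      rw [h'] at h
      exact (congrArg (inr (φ s)) (pair_split w v')).trans h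

theorem exists_pair {w : List S} {t : T} (v : Var (w.flatMap φ) t) :
    ∃ (s : S) (a : Var w s) (b : Var (φ s) t), pair φ a b = v :=
  ⟨_, _, _, pair_split w v⟩

end Var

/-- The terms for the signature `S` with sorted variables in `X`. -/
inductive Term (S : Signature.{u}) (X : S.Srt → Type u) : S.Srt → Type u
  | var {s : S.Srt} (x : X s) : Term S X s
  | op {w : List S.Srt} {s : S.Srt} (σ : S.Op w s) (args : ∀ t, Var w t → Term S X t) : Term S X s

/-- An algebra for the signature `S`. -/
structure Alg (S : Signature.{u}) : Type (u + 1) where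
  /-- The underlying sorted set. -/
  carrier : S.Srt → Type u
  /-- The operation that corresponds to a formal operation. -/
  op : ∀ {w : List S.Srt} {s : S.Srt}, S.Op w s → Tuple carrier w → carrier s

namespace Alg

variable {S : Signature.{u}}

/-- A homomorphism of algebras. -/
@[ext]
structure Hom (A B : Alg S) : Type u where
  /-- The underlying sorted mapping. -/
  toFun : ∀ s, A.carrier s → B.carrier s
  /-- The mapping commutes with the operations. -/
  map_op : ∀ {w : List S.Srt} {s : S.Srt} (σ : S.Op w s) (a : Tuple A.carrier w),
    toFun s (A.op σ a) = B.op σ (fun t v => toFun t (a t v))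

/-- Algebras and homomorphisms form a category. -/
instance : Category (Alg S) where
  Hom A B := Hom A B
  id A := ⟨fun _ a => a, fun _ _ => rfl⟩
  comp f g := ⟨fun s a => g.toFun s (f.toFun s a), fun σ a => by rw [f.map_op, g.map_op]⟩

@[ext]
theorem hom_ext {A B : Alg S} {f g : A ⟶ B} (h : ∀ s a, f.toFun s a = g.toFun s a) : f = g :=
  Hom.ext (funext fun s => funext fun a => h s a)

/-- The algebra of terms, which is the free algebra on a sorted set. -/
def free (S : Signature.{u}) (X : S.Srt → Type u) : Alg S where
  carrier := Term S X
  op := Term.op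

/-- The functor from algebras to sorted sets that forgets the operations. -/
def forgetFunctor (S : Signature.{u}) : Alg S ⥤ (S.Srt → Type u) where
  obj A := A.carrier
  map f := fun s => ↾(f.toFun s)

end Alg

namespace Term

variable {S : Signature.{u}} {X Y : S.Srt → Type u}

/-- The canonical extension of a valuation of the variables to the terms. -/
def eval (A : Alg S) (f : ∀ s, X s → A.carrier s) : {s : S.Srt} → Term S X s → A.carrier s
  | _, var x => f _ x
  | _, op σ args => A.op σ (fun t v => eval A f (args t v))

/-- Substitution of terms for the variables of a term. -/
def subst (f : ∀ s, X s → Term S Y s) {s : S.Srt} (P : Term S X s) : Term S Y s :=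
  eval (Alg.free S Y) f P

/-- Renaming of the variables of a term. -/
def rename (f : ∀ s, X s → Y s) {s : S.Srt} (P : Term S X s) : Term S Y s :=
  P.subst (fun s x => var (f s x))

@[simp]
theorem eval_var_apply (A : Alg S) (f : ∀ s, X s → A.carrier s) {s : S.Srt} (x : X s) :
    eval A f (var x) = f s x := rfl

@[simp]
theorem eval_op_apply (A : Alg S) (f : ∀ s, X s → A.carrier s) {w : List S.Srt} {s : S.Srt}
    (σ : S.Op w s) (args : ∀ t, Var w t → Term S X t) :
    eval A f (op σ args) = A.op σ (fun t v => eval A f (args t v)) := rfl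

@[simp]
theorem eval_free_op (A : Alg S) (f : ∀ s, X s → A.carrier s) {w : List S.Srt} {s : S.Srt}
    (σ : S.Op w s) (args : ∀ t, Var w t → Term S X t) :
    eval A f ((Alg.free S X).op σ args) = A.op σ (fun t v => eval A f (args t v)) := rfl

theorem hom_eval {A B : Alg S} (h : A ⟶ B) (f : ∀ s, X s → A.carrier s) :
    {s : S.Srt} → (P : Term S X s) → h.toFun s (eval A f P) = eval B (fun s x => h.toFun s (f s x)) P
  | _, var _ => rfl
  | _, op σ args => by
    rw [eval_op_apply, eval_op_apply, h.map_op]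
    exact congrArg _ (funext fun t => funext fun v => hom_eval h f (args t v))

/-- The canonical extension of a valuation, as a homomorphism. -/
def evalHom (A : Alg S) (f : ∀ s, X s → A.carrier s) : Alg.free S X ⟶ A :=
  Alg.Hom.mk (fun _ P => eval A f P) (fun _ _ => rfl)

@[simp]
theorem eval_subst (A : Alg S) (f : ∀ s, Y s → A.carrier s) (g : ∀ s, X s → Term S Y s)
    {s : S.Srt} (P : Term S X s) :
    eval A f (P.subst g) = eval A (fun s x => eval A f (g s x)) P :=
  hom_eval (evalHom A f) g P

@[simp]
theorem eval_free (A : Alg S) (f : ∀ s, Y s → A.carrier s) (g : ∀ s, X s → Term S Y s)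
    {s : S.Srt} (P : Term S X s) :
    eval A f (eval (Alg.free S Y) g P) = eval A (fun s x => eval A f (g s x)) P :=
  eval_subst A f g P

@[simp]
theorem eval_rename (A : Alg S) (f : ∀ s, Y s → A.carrier s) (g : ∀ s, X s → Y s)
    {s : S.Srt} (P : Term S X s) :
    eval A f (P.rename g) = eval A (fun s x => f s (g s x)) P :=
  eval_subst A f _ P

@[simp]
theorem subst_var : {s : S.Srt} → (P : Term S X s) → P.subst (fun _ x => var x) = P
  | _, var _ => rfl
  | _, op σ args => congrArg (op σ) (funext fun t => funext fun v => subst_var (args t v))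

@[simp]
theorem eval_free_var {s : S.Srt} (P : Term S X s) :
    eval (Alg.free S X) (fun _ x => var x) P = P := subst_var P

/-- Terms are equal if they have equal values under all valuations in all algebras. -/
theorem ext_eval {s : S.Srt} {P Q : Term S X s}
    (h : ∀ (A : Alg S) (f : ∀ s, X s → A.carrier s), eval A f P = eval A f Q) : P = Q := by
  rw [← eval_free_var P, ← eval_free_var Q]
  exact h _ _

end Term

namespace Alg

/-- The functor that sends a sorted set to its free algebra. -/
def freeFunctor (S : Signature.{u}) : (S.Srt → Type u) ⥤ Alg S where
  obj X := free S X
  map f := Term.evalHom _ (fun s x => Term.var (f s x))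
  map_id _ := hom_ext fun _ P => Term.subst_var P
  map_comp {_ _ Z} f g := hom_ext fun _ P => (Term.eval_free (free S Z)
    (fun s x => Term.var (g s x)) (fun s x => Term.var (f s x)) P).symm

/-- Free algebras are left adjoint to the forgetful functor. -/
def freeAdj (S : Signature.{u}) : freeFunctor S ⊣ forgetFunctor S :=
  Adjunction.mkOfHomEquiv
    { homEquiv := fun X A =>
        { toFun := fun h s => ↾(fun x => h.toFun s (Term.var x))
          invFun := fun f => Term.evalHom A (fun s x => f s x)
          left_inv := fun h => hom_ext fun s P =>
            (Term.hom_eval (A := free S X) h (fun _ x => Term.var x) P).symm.trans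
              (congrArg (h.toFun s) (Term.eval_free_var P))
          right_inv := fun _ => rfl }
      homEquiv_naturality_left_symm := fun {_ X A} f g => hom_ext fun _ P =>
        (Term.eval_free (X := _) (Y := X) A (fun s x => g s x)
          (fun s x => Term.var (f s x)) P).symm
      homEquiv_naturality_right := fun _ _ => rfl }

end Alg

/-- The term monad of a signature on the category of sorted sets. -/
def termMonad (S : Signature.{u}) : Monad (S.Srt → Type u) :=
  (Alg.freeAdj S).toMonad

namespace termMonad

variable (S : Signature.{u})

theorem obj_apply (X : S.Srt → Type u) (s : S.Srt) : (termMonad S).obj X s = Term S X s := rfl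

theorem map_apply {X Y : S.Srt → Type u} (f : X ⟶ Y) (s : S.Srt) (P : Term S X s) :
    ((termMonad S).map f s) P = P.rename (fun s x => f s x) := rfl

theorem unit_apply (X : S.Srt → Type u) (s : S.Srt) (x : X s) :
    ((termMonad S).η.app X s) x = Term.var x := rfl

theorem mult_apply (X : S.Srt → Type u) (s : S.Srt) (P : Term S (Term S X) s) :
    ((termMonad S).μ.app X s) P = P.subst (fun _ Q => Q) := rfl

end termMonad

/-- The family over the word `w.flatMap φ` that is given by families over the words `φ s`, one for
every variable of `w`. -/
def Tuple.flat {S T : Type u} {X : T → Type u} (φ : S → List T) {w : List S}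
    (a : ∀ s, Var w s → Tuple X (φ s)) : Tuple X (w.flatMap φ) :=
  fun t v => a _ (Var.split φ w v).2.1 t (Var.split φ w v).2.2

/-- The family over a word of length one that is given by one element. -/
def Tuple.single {T : Type u} {X : T → Type u} {s : T} (x : X s) : Tuple X [s]
  | _, Var.here => x

section TupleLemmas

variable {S T : Type u} {X : T → Type u} (φ : S → List T) {w : List S}

@[simp]
theorem Tuple.flat_pair (a : ∀ s, Var w s → Tuple X (φ s)) {s : S} (x : Var w s) {t : T}
    (y : Var (φ s) t) : Tuple.flat φ a t (Var.pair φ x y) = a s x t y := by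
  unfold Tuple.flat
  rw [Var.split_pair]

theorem Tuple.flat_eta (f : Tuple X (w.flatMap φ)) :
    Tuple.flat φ (fun _ x t y => f t (Var.pair φ x y)) = f := by
  funext t v
  obtain ⟨s, x, y, rfl⟩ := Var.exists_pair v
  simp

@[simp]
theorem Tuple.single_here {s : T} (x : X s) : Tuple.single x s Var.here = x := rfl

end TupleLemmas

/-- A polyderivor from `S` to `T` sends a sort of `S` to a word of sorts of `T`, and a formal
operation `σ : w → s` of `S` to a family, over the word assigned to `s`, of terms for `T` in the
variables of the word assigned to `w`. -/
@[ext]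
structure Polyderivor (S T : Signature.{u}) : Type u where
  /-- The mapping from sorts to words. -/
  sort : S.Srt → List T.Srt
  /-- The mapping from formal operations to families of terms. -/
  op : ∀ {w : List S.Srt} {s : S.Srt}, S.Op w s →
    Tuple (Term T (Var (w.flatMap sort))) (sort s)

namespace Polyderivor

variable {S T U : Signature.{u}}

/-- The algebra for `S` that is derived along a polyderivor from an algebra for `T`. -/
@[reducible]
def derived (d : Polyderivor S T) (B : Alg T) : Alg S where
  carrier s := Tuple B.carrier (d.sort s)
  op σ a := fun t v => (d.op σ t v).eval B (Tuple.flat d.sort a)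

/-- The translation of terms in the variables of a word `w` along a polyderivor. -/
def sharp (d : Polyderivor S T) {w : List S.Srt} {s : S.Srt} (P : Term S (Var w) s) :
    Tuple (Term T (Var (w.flatMap d.sort))) (d.sort s) :=
  P.eval (d.derived (Alg.free T _)) (fun _ x _ y => Term.var (Var.pair d.sort x y))

/-- The identity polyderivor. -/
@[reducible]
protected def id (S : Signature.{u}) : Polyderivor S S where
  sort s := [s]
  op σ := Tuple.single (Term.op σ (fun _ x => Term.var (Var.pair (fun s => [s]) x Var.here)))

/-- The bijection of variables that identifies `(w.flatMap φ).flatMap ψ` with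
`w.flatMap (fun s => (φ s).flatMap ψ)`. -/
def reassoc {S T U : Type u} (φ : S → List T) (ψ : T → List U) {w : List S} :
    Tuple (Var (w.flatMap (fun s => (φ s).flatMap ψ))) ((w.flatMap φ).flatMap ψ) :=
  Tuple.flat ψ (Tuple.flat φ (fun _ x _ y _ z =>
    Var.pair (fun s => (φ s).flatMap ψ) x (Var.pair ψ y z)))

/-- The composite of polyderivors: formal operations are sent to the translations along `e` of the
terms that `d` assigns to them. -/
@[reducible]
protected def comp (d : Polyderivor S T) (e : Polyderivor T U) : Polyderivor S U where
  sort s := (d.sort s).flatMap e.sort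
  op σ := Tuple.flat e.sort (fun _ x _ y =>
    (e.sharp (d.op σ _ x) _ y).rename (reassoc d.sort e.sort))

/-- A homomorphism induces a homomorphism of derived algebras. -/
def derivedMap (d : Polyderivor S T) {A B : Alg T} (h : A ⟶ B) : d.derived A ⟶ d.derived B :=
  Alg.Hom.mk (fun _ a t v => h.toFun t (a t v)) (fun {w s} σ a => by
    funext t v
    exact Term.hom_eval h _ _)

@[simp]
theorem eval_derived_free (d : Polyderivor S T) (B : Alg T) {X : S.Srt → Type u}
    {Y : T.Srt → Type u} (f : ∀ t, Y t → B.carrier t)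
    (g : ∀ s, X s → Tuple (Term T Y) (d.sort s)) {s : S.Srt} (P : Term S X s) (t : T.Srt)
    (v : Var (d.sort s) t) :
    (Term.eval (d.derived (Alg.free T Y)) g P t v).eval B f =
      P.eval (d.derived B) (fun s x t v => (g s x t v).eval B f) t v :=
  congrFun (congrFun (Term.hom_eval (d.derivedMap (Term.evalHom B f)) g P) t) v

@[simp]
theorem eval_sharp (d : Polyderivor S T) (B : Alg T) {w : List S.Srt} {s : S.Srt}
    (P : Term S (Var w) s) (f : Tuple B.carrier (w.flatMap d.sort)) (t : T.Srt)
    (v : Var (d.sort s) t) :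
    (d.sharp P t v).eval B f =
      P.eval (d.derived B) (fun _ x _ y => f _ (Var.pair d.sort x y)) t v :=
  d.eval_derived_free B f _ P t v

theorem comp_derived_op (d : Polyderivor S T) (e : Polyderivor T U) (B : Alg U)
    {w : List S.Srt} {s : S.Srt} (σ : S.Op w s)
    (q : Tuple ((d.comp e).derived B).carrier w) {t : T.Srt} {u : U.Srt}
    (x : Var (d.sort s) t) (y : Var (e.sort t) u) :
    ((d.comp e).derived B).op σ q u (Var.pair e.sort x y) =
      (d.derived (e.derived B)).op σ
        (fun s z _ x _ y => q s z _ (Var.pair e.sort x y)) t x u y := by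
  have h := e.eval_sharp B (d.op σ t x) (fun t v => Tuple.flat (fun s => (d.sort s).flatMap e.sort)
    q t (reassoc d.sort e.sort t v)) u y
  simp only [Tuple.flat_pair, Term.eval_rename]
  refine h.trans (congrArg (fun g => Term.eval (e.derived B) g (d.op σ t x) u y) ?_)
  funext t' c
  obtain ⟨s', x', y', rfl⟩ := Var.exists_pair c
  funext u' z
  simp [reassoc]

theorem id_derived_op (B : Alg S) {w : List S.Srt} {s : S.Srt} (σ : S.Op w s)
    (q : Tuple ((Polyderivor.id S).derived B).carrier w) :
    ((Polyderivor.id S).derived B).op σ q s Var.here =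
      B.op σ (fun t x => q t x t Var.here) := by
  simp [Polyderivor.id]

@[simp]
theorem eval_comp_derived (d : Polyderivor S T) (e : Polyderivor T U) (B : Alg U)
    {X : S.Srt → Type u} (f : ∀ s, X s → Tuple B.carrier ((d.sort s).flatMap e.sort))
    {s : S.Srt} (P : Term S X s) {t : T.Srt} {u : U.Srt} (x : Var (d.sort s) t)
    (y : Var (e.sort t) u) :
    P.eval ((d.comp e).derived B) f u (Var.pair e.sort x y) =
      P.eval (d.derived (e.derived B)) (fun s a _ x _ y => f s a _ (Var.pair e.sort x y)) t x u y :=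
  congrFun (congrFun (congrFun (congrFun (Term.hom_eval
    (A := (d.comp e).derived B) (B := d.derived (e.derived B))
    (Alg.Hom.mk (fun _ q _ x _ y => q _ (Var.pair e.sort x y)) (fun σ q => by
      funext t x u y
      exact comp_derived_op d e B σ q x y)) f P) t) x) u) y

@[simp]
theorem eval_id_derived (B : Alg S) {X : S.Srt → Type u} (f : ∀ s, X s → Tuple B.carrier [s])
    {s : S.Srt} (P : Term S X s) :
    P.eval ((Polyderivor.id S).derived B) f s Var.here =
      P.eval B (fun s a => f s a s Var.here) :=
  Term.hom_eval (A := (Polyderivor.id S).derived B) (B := B)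
    (Alg.Hom.mk (fun s q => q s Var.here) (fun σ q => id_derived_op B σ q)) f P

end Polyderivor

/-- A transformation from `d` to `e` assigns to a sort `s` a family, over the word assigned to `s`
by `e`, of terms in the variables of the word assigned to `s` by `d`, in such a way that for every
formal operation `σ : w → s` the substitution of the terms `d σ` into the family at `s` equals the
substitution, into the terms `e σ`, of the families at the sorts in `w`. -/
@[ext]
structure Transformation {S T : Signature.{u}} (d e : Polyderivor S T) : Type u where
  /-- The terms of the transformation. -/
  app : ∀ s : S.Srt, Tuple (Term T (Var (d.sort s))) (e.sort s)
  /-- The compatibility with the formal operations. -/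
  naturality : ∀ {w : List S.Srt} {s : S.Srt} (σ : S.Op w s) (t : T.Srt) (v : Var (e.sort s) t),
    (app s t v).subst (d.op σ) =
      (e.op σ t v).subst (Tuple.flat e.sort (fun s' x t' y =>
        (app s' t' y).rename (fun _ z => Var.pair d.sort x z)))

namespace Transformation

variable {S T U : Signature.{u}}

/-- A family of terms that induces homomorphisms of derived algebras is a transformation. -/
def ofEval {d e : Polyderivor S T} (app : ∀ s : S.Srt, Tuple (Term T (Var (d.sort s))) (e.sort s))
    (h : ∀ (B : Alg T) {w : List S.Srt} {s : S.Srt} (σ : S.Op w s)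
      (q : Tuple (d.derived B).carrier w) (t : T.Srt) (v : Var (e.sort s) t),
      (app s t v).eval B ((d.derived B).op σ q) =
        (e.derived B).op σ (fun s' x t' y => (app s' t' y).eval B (q s' x)) t v) :
    Transformation d e where
  app := app
  naturality {w s} σ t v := by
    refine Term.ext_eval fun A f => ?_
    have key := h A σ (fun _ x t y => f t (Var.pair d.sort x y)) t v
    simp only [Tuple.flat_eta] at key
    rw [Term.eval_subst, Term.eval_subst, key]
    congr 1
    funext t' c
    obtain ⟨s', x', y', rfl⟩ := Var.exists_pair c
    simp

/-- The homomorphism between derived algebras that a transformation induces. -/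
def hom {d e : Polyderivor S T} (ξ : Transformation d e) (B : Alg T) :
    d.derived B ⟶ e.derived B :=
  Alg.Hom.mk (fun s q t v => (ξ.app s t v).eval B q) (fun {w s} σ q => by
    funext t v
    have key := congrArg (Term.eval B (Tuple.flat d.sort q)) (ξ.naturality σ t v)
    rw [Term.eval_subst, Term.eval_subst] at key
    refine key.trans ?_
    simp only
    congr 1
    funext t' c
    obtain ⟨s', x', y', rfl⟩ := Var.exists_pair c
    simp)

theorem eval_op {d e : Polyderivor S T} (ξ : Transformation d e) (B : Alg T) {w : List S.Srt}
    {s : S.Srt} (σ : S.Op w s) (q : Tuple (d.derived B).carrier w) (t : T.Srt)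
    (v : Var (e.sort s) t) :
    (ξ.app s t v).eval B ((d.derived B).op σ q) =
      (e.derived B).op σ (fun s' x t' y => (ξ.app s' t' y).eval B (q s' x)) t v :=
  congrFun (congrFun ((ξ.hom B).map_op σ q) t) v

theorem eval_eval {d e : Polyderivor S T} (ξ : Transformation d e) (B : Alg T)
    {X : S.Srt → Type u} (f : ∀ s, X s → Tuple B.carrier (d.sort s)) {s : S.Srt} (P : Term S X s)
    (t : T.Srt) (v : Var (e.sort s) t) :
    (ξ.app s t v).eval B (P.eval (d.derived B) f) =
      P.eval (e.derived B) (fun s x t v => (ξ.app s t v).eval B (f s x)) t v :=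
  congrFun (congrFun (Term.hom_eval (ξ.hom B) f P) t) v

/-- The identity transformation consists of variables. -/
protected def id (d : Polyderivor S T) : Transformation d d :=
  ofEval (fun _ _ v => Term.var v) (fun _ _ _ _ _ _ _ => rfl)

/-- The vertical composite is given by substitution. -/
protected def comp {d e f : Polyderivor S T} (ξ : Transformation d e) (χ : Transformation e f) :
    Transformation d f :=
  ofEval (fun s t v => (χ.app s t v).subst (ξ.app s)) (fun B w s σ q t v => by
    have h : (fun t v => (ξ.app s t v).eval B ((d.derived B).op σ q)) =
        (e.derived B).op σ (fun s' x t' y => (ξ.app s' t' y).eval B (q s' x)) :=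
      funext fun t => funext fun v => ξ.eval_op B σ q t v
    simp only [Term.eval_subst]
    rw [h, χ.eval_op])

/-- The horizontal composite of a polyderivor with a transformation. -/
def whiskerLeft (d : Polyderivor S T) {e f : Polyderivor T U} (χ : Transformation e f) :
    Transformation (d.comp e) (d.comp f) :=
  ofEval (fun _ => Tuple.flat f.sort (fun t x _ y =>
      (χ.app t _ y).rename (fun _ z => Var.pair e.sort x z))) (fun B w s σ q u v => by
    obtain ⟨t, x, y, rfl⟩ := Var.exists_pair v
    rw [Polyderivor.comp_derived_op]
    rw [Tuple.flat_pair, Term.eval_rename]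
    refine (congrArg (fun g => Term.eval B g (χ.app t u y)) (funext fun u => funext fun z =>
      Polyderivor.comp_derived_op d e B σ q x z)).trans ?_
    have key := χ.eval_eval B (Tuple.flat d.sort
      (fun s z _ x _ y => q s z _ (Var.pair e.sort x y))) (d.op σ t x) u y
    refine key.trans (congrArg (fun g => Term.eval (f.derived B) g (d.op σ t x) u y) ?_)
    funext t' c
    obtain ⟨s', x', y', rfl⟩ := Var.exists_pair c
    funext u' z
    simp)

/-- The horizontal composite of a transformation with a polyderivor. -/
def whiskerRight {d e : Polyderivor S T} (ξ : Transformation d e) (f : Polyderivor T U) :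
    Transformation (d.comp f) (e.comp f) :=
  ofEval (fun s => Tuple.flat f.sort (fun t x => f.sharp (ξ.app s t x))) (fun B w s σ q u v => by
    obtain ⟨t, x, y, rfl⟩ := Var.exists_pair v
    rw [Polyderivor.comp_derived_op]
    rw [Tuple.flat_pair, Polyderivor.eval_sharp]
    refine (congrArg (fun g => Term.eval (f.derived B) g (ξ.app s t x) u y)
      (funext fun t => funext fun x => funext fun u => funext fun z =>
        Polyderivor.comp_derived_op d f B σ q x z)).trans ?_
    refine (congrFun (congrFun (ξ.eval_op (f.derived B) σ
      (fun s z _ x _ y => q s z _ (Var.pair f.sort x y)) t x) u) y).trans ?_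
    refine congrArg (fun g => (e.derived (f.derived B)).op σ g t x u y) ?_
    funext s' z t' x' u' y'
    simp)

end Transformation

namespace Transformation

variable {S T U V : Signature.{u}}

@[simp]
theorem ofEval_app {d e : Polyderivor S T} (app : ∀ s, Tuple (Term T (Var (d.sort s))) (e.sort s))
    (h : ∀ (B : Alg T) {w : List S.Srt} {s : S.Srt} (σ : S.Op w s)
      (q : Tuple (d.derived B).carrier w) (t : T.Srt) (v : Var (e.sort s) t),
      (app s t v).eval B ((d.derived B).op σ q) =
        (e.derived B).op σ (fun s' x t' y => (app s' t' y).eval B (q s' x)) t v) :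
    (ofEval app h).app = app := rfl

/-- The canonical renaming of variables between the two composites of three polyderivors. -/
def assoc (d : Polyderivor S T) (e : Polyderivor T U) (f : Polyderivor U V) :
    Transformation ((d.comp e).comp f) (d.comp (e.comp f)) :=
  ofEval (fun _ => Tuple.flat (e.comp f).sort (fun _ x => Tuple.flat f.sort (fun _ y _ z =>
      Term.var (Var.pair f.sort (Var.pair e.sort x y) z)))) (fun B w s σ q _ v => by
    obtain ⟨t, x, v, rfl⟩ := Var.exists_pair v
    obtain ⟨u, y, z, rfl⟩ := Var.exists_pair v
    rw [Polyderivor.comp_derived_op, Tuple.flat_pair, Tuple.flat_pair]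
    refine (Polyderivor.comp_derived_op (d.comp e) f B σ q (Var.pair e.sort x y) z).trans ?_
    rw [Polyderivor.comp_derived_op]
    refine Eq.trans ?_ (Polyderivor.eval_comp_derived e f B _ (d.op σ t x) y z).symm
    refine congrArg (fun g => Term.eval (e.derived (f.derived B)) g (d.op σ t x) u y _ z) ?_
    funext t' c
    obtain ⟨s', x', y', rfl⟩ := Var.exists_pair c
    funext u' y' v' z'
    simp)

/-- The canonical renaming of variables between the two composites of three polyderivors. -/
def assocInv (d : Polyderivor S T) (e : Polyderivor T U) (f : Polyderivor U V) :
    Transformation (d.comp (e.comp f)) ((d.comp e).comp f) :=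
  ofEval (fun _ => Tuple.flat f.sort (Tuple.flat e.sort (fun _ x _ y _ z =>
      Term.var (Var.pair (e.comp f).sort x (Var.pair f.sort y z))))) (fun B w s σ q _ v => by
    obtain ⟨u, v, z, rfl⟩ := Var.exists_pair v
    obtain ⟨t, x, y, rfl⟩ := Var.exists_pair v
    rw [Polyderivor.comp_derived_op, Polyderivor.comp_derived_op, Tuple.flat_pair, Tuple.flat_pair]
    refine (Polyderivor.comp_derived_op d (e.comp f) B σ q x (Var.pair f.sort y z)).trans ?_
    refine (Polyderivor.eval_comp_derived e f B _ (d.op σ t x) y z).trans ?_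
    refine congrArg (fun g => Term.eval (e.derived (f.derived B)) g (d.op σ t x) u y _ z) ?_
    funext t' c
    obtain ⟨s', x', y', rfl⟩ := Var.exists_pair c
    funext u' y' v' z'
    simp)

/-- The canonical renaming of variables for the composite with an identity on the left. -/
def leftUnit (d : Polyderivor S T) : Transformation ((Polyderivor.id S).comp d) d :=
  ofEval (fun _ _ v => Term.var (Var.pair d.sort Var.here v)) (fun B w s σ q t v => by
    refine (Polyderivor.comp_derived_op (Polyderivor.id S) d B σ q Var.here v).trans ?_
    rw [Polyderivor.id_derived_op]
    rfl)

/-- The canonical renaming of variables for the composite with an identity on the left. -/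
def leftUnitInv (d : Polyderivor S T) : Transformation d ((Polyderivor.id S).comp d) :=
  ofEval (fun s => Tuple.flat (w := [s]) d.sort
      (Tuple.single (X := fun s' => Tuple (Term T (Var (d.sort s))) (d.sort s'))
        (fun _ v => Term.var v))) (fun B w s σ q t v => by
    obtain ⟨s', x, y, rfl⟩ := Var.exists_pair (w := [s]) v
    cases x with
    | there x => cases x
    | here =>
    rw [Polyderivor.comp_derived_op, Polyderivor.id_derived_op, Tuple.flat_pair, Tuple.single_here]
    refine congrArg (fun g => (d.derived B).op σ g t y) ?_
    funext s' x t' y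
    simp)

/-- The canonical renaming of variables for the composite with an identity on the right. -/
def rightUnit (d : Polyderivor S T) : Transformation (d.comp (Polyderivor.id T)) d :=
  ofEval (fun _ _ v => Term.var (Var.pair (Polyderivor.id T).sort v Var.here))
    (fun B w s σ q t v => by
    refine (Polyderivor.comp_derived_op d (Polyderivor.id T) B σ q v Var.here).trans ?_
    refine (Polyderivor.eval_id_derived B _ (d.op σ t v)).trans ?_
    refine congrArg (fun g => Term.eval B g (d.op σ t v)) ?_
    funext t' c
    obtain ⟨s', x', y', rfl⟩ := Var.exists_pair c
    simp)

/-- The canonical renaming of variables for the composite with an identity on the right. -/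
def rightUnitInv (d : Polyderivor S T) : Transformation d (d.comp (Polyderivor.id T)) :=
  ofEval (fun s => Tuple.flat (Polyderivor.id T).sort (fun _ x =>
      Tuple.single (X := Term T (Var (d.sort s))) (Term.var x))) (fun B w s σ q t v => by
    obtain ⟨t', x, y, rfl⟩ := Var.exists_pair v
    cases y with
    | there y => cases y
    | here =>
    rw [Polyderivor.comp_derived_op, Tuple.flat_pair, Tuple.single_here]
    refine Eq.trans ?_ (Polyderivor.eval_id_derived B _ (d.op σ t x)).symm
    refine congrArg (fun g => Term.eval B g (d.op σ t x)) ?_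
    funext t' c
    obtain ⟨s', x', y', rfl⟩ := Var.exists_pair c
    simp)

@[simp]
theorem id_app (d : Polyderivor S T) {s : S.Srt} {t : T.Srt} (v : Var (d.sort s) t) :
    (Transformation.id d).app s t v = Term.var v := rfl

@[simp]
theorem comp_app {d e f : Polyderivor S T} (ξ : Transformation d e) (χ : Transformation e f)
    {s : S.Srt} {t : T.Srt} (v : Var (f.sort s) t) :
    (ξ.comp χ).app s t v = (χ.app s t v).subst (ξ.app s) := rfl

@[simp]
theorem whiskerLeft_app (d : Polyderivor S T) {e f : Polyderivor T U} (χ : Transformation e f)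
    {s : S.Srt} {t : T.Srt} {u : U.Srt} (x : Var (d.sort s) t) (y : Var (f.sort t) u) :
    (χ.whiskerLeft d).app s u (Var.pair f.sort x y) =
      (χ.app t u y).rename (fun _ z => Var.pair e.sort x z) := by
  simp [whiskerLeft]

@[simp]
theorem whiskerRight_app {d e : Polyderivor S T} (ξ : Transformation d e) (f : Polyderivor T U)
    {s : S.Srt} {t : T.Srt} {u : U.Srt} (x : Var (e.sort s) t) (y : Var (f.sort t) u) :
    (ξ.whiskerRight f).app s u (Var.pair f.sort x y) = f.sharp (ξ.app s t x) u y := by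
  simp [whiskerRight]

@[simp]
theorem whiskerRight_app_id {d e : Polyderivor S T} (ξ : Transformation d e)
    {s : S.Srt} {t u : T.Srt} (x : Var (e.sort s) t) (y : Var [t] u) :
    (ξ.whiskerRight (Polyderivor.id T)).app s u (Var.pair (fun t => [t]) x y) =
      (Polyderivor.id T).sharp (ξ.app s t x) u y :=
  whiskerRight_app ξ (Polyderivor.id T) x y

@[simp]
theorem whiskerRight_app_comp {d e : Polyderivor S T} (ξ : Transformation d e)
    (f : Polyderivor T U) (g : Polyderivor U V) {s : S.Srt} {t : T.Srt} {v : V.Srt}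
    (x : Var (e.sort s) t) (y : Var ((f.sort t).flatMap g.sort) v) :
    (ξ.whiskerRight (f.comp g)).app s v (Var.pair (fun t => (f.sort t).flatMap g.sort) x y) =
      (f.comp g).sharp (ξ.app s t x) v y :=
  whiskerRight_app ξ (f.comp g) x y

@[simp]
theorem assoc_app (d : Polyderivor S T) (e : Polyderivor T U) (f : Polyderivor U V)
    {s : S.Srt} {t : T.Srt} {u : U.Srt} {v : V.Srt} (x : Var (d.sort s) t) (y : Var (e.sort t) u)
    (z : Var (f.sort u) v) :
    (assoc d e f).app s v (Var.pair (fun t => (e.sort t).flatMap f.sort) x (Var.pair f.sort y z)) =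
      Term.var (Var.pair f.sort (Var.pair e.sort x y) z) := by
  simp [assoc]

@[simp]
theorem assocInv_app (d : Polyderivor S T) (e : Polyderivor T U) (f : Polyderivor U V)
    {s : S.Srt} {t : T.Srt} {u : U.Srt} {v : V.Srt} (x : Var (d.sort s) t) (y : Var (e.sort t) u)
    (z : Var (f.sort u) v) :
    (assocInv d e f).app s v (Var.pair f.sort (Var.pair e.sort x y) z) =
      Term.var (Var.pair (fun t => (e.sort t).flatMap f.sort) x (Var.pair f.sort y z)) := by
  simp [assocInv]

@[simp]
theorem whiskerLeft_app_comp (d : Polyderivor S T) {e : Polyderivor T V} (f : Polyderivor T U)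
    (g : Polyderivor U V) (χ : Transformation e (f.comp g)) {s : S.Srt} {t : T.Srt} {v : V.Srt}
    (x : Var (d.sort s) t) (y : Var ((f.sort t).flatMap g.sort) v) :
    (χ.whiskerLeft d).app s v (Var.pair (fun t => (f.sort t).flatMap g.sort) x y) =
      (χ.app t v y).rename (fun _ z => Var.pair e.sort x z) :=
  whiskerLeft_app d χ x y

@[simp]
theorem whiskerLeft_app_comp_comp {W : Signature.{u}} (d : Polyderivor S T) {e : Polyderivor T W}
    (f : Polyderivor T U) (g : Polyderivor U V) (h : Polyderivor V W)
    (χ : Transformation e (f.comp (g.comp h))) {s : S.Srt} {t : T.Srt} {v : W.Srt}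
    (x : Var (d.sort s) t) (y : Var ((f.sort t).flatMap (g.comp h).sort) v) :
    (χ.whiskerLeft d).app s v
        (Var.pair (fun t => (f.sort t).flatMap (fun s => (g.sort s).flatMap h.sort)) x y) =
      (χ.app t v y).rename (fun _ z => Var.pair e.sort x z) :=
  whiskerLeft_app d χ x y

@[simp]
theorem assoc_app_comp {W : Signature.{u}} (d : Polyderivor S T) (e : Polyderivor T U)
    (f : Polyderivor U V) (g : Polyderivor V W) {s : S.Srt} {t : T.Srt} {u : U.Srt} {v : W.Srt}
    (x : Var (d.sort s) t) (y : Var (e.sort t) u) (z : Var ((f.sort u).flatMap g.sort) v) :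
    (assoc d e (f.comp g)).app s v
        (Var.pair (fun s => (e.sort s).flatMap (fun s => (f.sort s).flatMap g.sort)) x
          (Var.pair (fun s => (f.sort s).flatMap g.sort) y z)) =
      Term.var (Var.pair (fun s => (f.sort s).flatMap g.sort) (Var.pair e.sort x y) z) :=
  assoc_app d e (f.comp g) x y z

@[simp]
theorem leftUnit_app (d : Polyderivor S T) {s : S.Srt} {t : T.Srt} (v : Var (d.sort s) t) :
    (leftUnit d).app s t v = Term.var (Var.pair d.sort Var.here v) := rfl

@[simp]
theorem leftUnitInv_app (d : Polyderivor S T) {s : S.Srt} {t : T.Srt} (v : Var (d.sort s) t) :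
    (leftUnitInv d).app s t (Var.pair (w := [s]) d.sort Var.here v) = Term.var v := by
  simp [leftUnitInv]

@[simp]
theorem rightUnit_app (d : Polyderivor S T) {s : S.Srt} {t : T.Srt} (v : Var (d.sort s) t) :
    (rightUnit d).app s t v = Term.var (Var.pair (fun t => [t]) v Var.here) := rfl

@[simp]
theorem rightUnitInv_app (d : Polyderivor S T) {s : S.Srt} {t : T.Srt} (v : Var (d.sort s) t) :
    (rightUnitInv d).app s t (Var.pair (fun t => [t]) v Var.here) = Term.var v := by
  simp [rightUnitInv]

/-- Transformations are equal if they induce the same mappings on all algebras. -/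
theorem ext_eval {d e : Polyderivor S T} {ξ χ : Transformation d e}
    (h : ∀ (s : S.Srt) (t : T.Srt) (v : Var (e.sort s) t) (B : Alg T)
      (q : Tuple B.carrier (d.sort s)), (ξ.app s t v).eval B q = (χ.app s t v).eval B q) : ξ = χ :=
  Transformation.ext (funext fun s => funext fun t => funext fun v =>
    Term.ext_eval fun B q => h s t v B q)

section Laws

variable {W : Signature.{u}} (d : Polyderivor S T) (e : Polyderivor T U) (f : Polyderivor U V)
  (g : Polyderivor V W)

theorem assoc_comp_assocInv :
    (assoc d e f).comp (assocInv d e f) = Transformation.id ((d.comp e).comp f) := by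
  refine ext_eval fun s _ v B q => ?_
  obtain ⟨_, v, z, rfl⟩ := Var.exists_pair v
  obtain ⟨_, x, y, rfl⟩ := Var.exists_pair v
  simp

theorem assocInv_comp_assoc :
    (assocInv d e f).comp (assoc d e f) = Transformation.id (d.comp (e.comp f)) := by
  refine ext_eval fun s _ v B q => ?_
  obtain ⟨_, x, v, rfl⟩ := Var.exists_pair v
  obtain ⟨_, y, z, rfl⟩ := Var.exists_pair v
  simp

theorem leftUnit_comp_leftUnitInv :
    (leftUnit d).comp (leftUnitInv d) = Transformation.id ((Polyderivor.id S).comp d) := by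
  refine ext_eval fun s _ v B q => ?_
  obtain ⟨_, x, v, rfl⟩ := Var.exists_pair (w := [s]) v
  cases x with
  | there x => cases x
  | here => simp

theorem leftUnitInv_comp_leftUnit :
    (leftUnitInv d).comp (leftUnit d) = Transformation.id d := by
  refine ext_eval fun s _ v B q => ?_
  simp

theorem rightUnit_comp_rightUnitInv :
    (rightUnit d).comp (rightUnitInv d) = Transformation.id (d.comp (Polyderivor.id T)) := by
  refine ext_eval fun s _ v B q => ?_
  obtain ⟨_, v, x, rfl⟩ := Var.exists_pair v
  cases x with
  | there x => cases x
  | here => simp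

theorem rightUnitInv_comp_rightUnit :
    (rightUnitInv d).comp (rightUnit d) = Transformation.id d := by
  refine ext_eval fun s _ v B q => ?_
  simp

variable {d' d'' : Polyderivor S T} {e' e'' : Polyderivor T U} {f' : Polyderivor U V}

theorem whiskerLeft_id :
    (Transformation.id e).whiskerLeft d = Transformation.id (d.comp e) := by
  refine ext_eval fun s _ v B q => ?_
  obtain ⟨_, x, y, rfl⟩ := Var.exists_pair v
  simp

theorem whiskerLeft_comp (ξ : Transformation e e') (χ : Transformation e' e'') :
    (ξ.comp χ).whiskerLeft d = (ξ.whiskerLeft d).comp (χ.whiskerLeft d) := by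
  refine ext_eval fun s _ v B q => ?_
  obtain ⟨_, x, y, rfl⟩ := Var.exists_pair v
  simp

theorem id_whiskerLeft (ξ : Transformation d d') :
    ξ.whiskerLeft (Polyderivor.id S) = (leftUnit d).comp (ξ.comp (leftUnitInv d')) := by
  refine ext_eval fun s _ v B q => ?_
  obtain ⟨_, x, v, rfl⟩ := Var.exists_pair (w := [s]) v
  cases x with
  | there x => cases x
  | here => simp

theorem comp_whiskerLeft (ξ : Transformation f f') :
    ξ.whiskerLeft (d.comp e) =
      (assoc d e f).comp (((ξ.whiskerLeft e).whiskerLeft d).comp (assocInv d e f')) := by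
  refine ext_eval fun s _ v B q => ?_
  obtain ⟨_, v, z, rfl⟩ := Var.exists_pair v
  obtain ⟨_, x, y, rfl⟩ := Var.exists_pair v
  simp

theorem id_whiskerRight :
    (Transformation.id d).whiskerRight e = Transformation.id (d.comp e) := by
  refine ext_eval fun s _ v B q => ?_
  obtain ⟨_, x, y, rfl⟩ := Var.exists_pair v
  simp

theorem comp_whiskerRight (ξ : Transformation d d') (χ : Transformation d' d'') :
    (ξ.comp χ).whiskerRight e = (ξ.whiskerRight e).comp (χ.whiskerRight e) := by
  refine ext_eval fun s _ v B q => ?_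
  obtain ⟨_, x, y, rfl⟩ := Var.exists_pair v
  simp

theorem whiskerRight_id (ξ : Transformation d d') :
    ξ.whiskerRight (Polyderivor.id T) = (rightUnit d).comp (ξ.comp (rightUnitInv d')) := by
  refine ext_eval fun s _ v B q => ?_
  obtain ⟨_, v, x, rfl⟩ := Var.exists_pair v
  cases x with
  | there x => cases x
  | here => simp

theorem whiskerRight_comp (ξ : Transformation d d') :
    ξ.whiskerRight (e.comp f) =
      (assocInv d e f).comp (((ξ.whiskerRight e).whiskerRight f).comp (assoc d' e f)) := by
  refine ext_eval fun s _ v B q => ?_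
  obtain ⟨_, x, v, rfl⟩ := Var.exists_pair v
  obtain ⟨_, y, z, rfl⟩ := Var.exists_pair v
  simp

theorem whisker_assoc (ξ : Transformation e e') :
    (ξ.whiskerLeft d).whiskerRight f =
      (assoc d e f).comp (((ξ.whiskerRight f).whiskerLeft d).comp (assocInv d e' f)) := by
  refine ext_eval fun s _ v B q => ?_
  obtain ⟨_, v, z, rfl⟩ := Var.exists_pair v
  obtain ⟨_, x, y, rfl⟩ := Var.exists_pair v
  simp

theorem whisker_exchange (ξ : Transformation d d') (χ : Transformation e e') :
    (χ.whiskerLeft d).comp (ξ.whiskerRight e') =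
      (ξ.whiskerRight e).comp (χ.whiskerLeft d') := by
  refine ext_eval fun s _ v B q => ?_
  obtain ⟨_, x, y, rfl⟩ := Var.exists_pair v
  simp only [comp_app, whiskerLeft_app, whiskerRight_app, Term.eval_subst, Term.eval_rename,
    Polyderivor.eval_sharp]
  exact (χ.eval_eval B (fun _ x _ y => q _ (Var.pair e.sort x y)) (ξ.app s _ x) _ y).symm

theorem pentagon :
    ((assoc d e f).whiskerRight g).comp
        ((assoc d (e.comp f) g).comp ((assoc e f g).whiskerLeft d)) =
      (assoc (d.comp e) f g).comp (assoc d e (f.comp g)) := by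
  refine ext_eval fun s _ v B q => ?_
  obtain ⟨_, x, v, rfl⟩ := Var.exists_pair v
  obtain ⟨_, y, v, rfl⟩ := Var.exists_pair v
  obtain ⟨_, z, v, rfl⟩ := Var.exists_pair v
  simp

theorem triangle :
    (assoc d (Polyderivor.id T) e).comp ((leftUnit e).whiskerLeft d) =
      (rightUnit d).whiskerRight e := by
  refine ext_eval fun s _ v B q => ?_
  obtain ⟨_, x, y, rfl⟩ := Var.exists_pair v
  simp

end Laws

end Transformation

/-- Polyderivors and transformations with vertical composition form a category. -/
instance {S T : Signature.{u}} : Category (Polyderivor S T) where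
  Hom := Transformation
  id := Transformation.id
  comp := Transformation.comp
  id_comp ξ := Transformation.ext_eval fun s t v B q => by simp
  comp_id ξ := Transformation.ext_eval fun s t v B q => by simp
  assoc ξ χ ζ := Transformation.ext_eval fun s t v B q => by simp

/-- The 2-category of signatures, polyderivors and transformations. Its associators and unitors are
the canonical renamings of variables. -/
instance : Bicategory Signature.{u} where
  Hom := Polyderivor
  id := Polyderivor.id
  comp := Polyderivor.comp
  homCategory _ _ := inferInstance
  whiskerLeft d _ _ χ := χ.whiskerLeft d
  whiskerRight ξ f := ξ.whiskerRight f
  associator d e f :=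
    { hom := Transformation.assoc d e f
      inv := Transformation.assocInv d e f
      hom_inv_id := Transformation.assoc_comp_assocInv d e f
      inv_hom_id := Transformation.assocInv_comp_assoc d e f }
  leftUnitor d :=
    { hom := Transformation.leftUnit d
      inv := Transformation.leftUnitInv d
      hom_inv_id := Transformation.leftUnit_comp_leftUnitInv d
      inv_hom_id := Transformation.leftUnitInv_comp_leftUnit d }
  rightUnitor d :=
    { hom := Transformation.rightUnit d
      inv := Transformation.rightUnitInv d
      hom_inv_id := Transformation.rightUnit_comp_rightUnitInv d
      inv_hom_id := Transformation.rightUnitInv_comp_rightUnit d }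
  whiskerLeft_id d e := Transformation.whiskerLeft_id d e
  whiskerLeft_comp d _ _ _ ξ χ := Transformation.whiskerLeft_comp d _ ξ χ
  id_whiskerLeft ξ := Transformation.id_whiskerLeft _ ξ
  comp_whiskerLeft d e _ _ ξ := Transformation.comp_whiskerLeft d e _ ξ
  id_whiskerRight d e := Transformation.id_whiskerRight d e
  comp_whiskerRight ξ χ e := Transformation.comp_whiskerRight _ e ξ χ
  whiskerRight_id ξ := Transformation.whiskerRight_id _ ξ
  whiskerRight_comp ξ d e := Transformation.whiskerRight_comp _ d e ξ
  whisker_assoc d _ _ ξ e := Transformation.whisker_assoc d _ e ξ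
  whisker_exchange ξ χ := Transformation.whisker_exchange _ _ ξ χ
  pentagon d e f g := Transformation.pentagon d e f g
  triangle d e := Transformation.triangle d e

universe v w v₁ v₂ v₃ v₄ w₁ w₂ w₃ w₄

/-- An adjoint square from the adjunction `F ⊣ G` to the adjunction `F' ⊣ G'` with top functor `J`
and bottom functor `H`: natural transformations `F'J ⟶ HF`, `J ⟶ G'HF`, `F'JG ⟶ H` and `JG ⟶ G'H`
(composition of functors written in the usual order) that correspond to one another under the two
adjunctions. -/
structure AdjointSquare {C : Type w₁} [Category.{v₁} C] {D : Type w₂} [Category.{v₂} D]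
    {C' : Type w₃} [Category.{v₃} C'] {D' : Type w₄} [Category.{v₄} D']
    {F : C ⥤ D} {G : D ⥤ C} (adj : F ⊣ G) {F' : C' ⥤ D'} {G' : D' ⥤ C'} (adj' : F' ⊣ G')
    (J : C ⥤ C') (H : D ⥤ D') where
  /-- The component `F'J ⟶ HF`. -/
  c0 : J ⋙ F' ⟶ F ⋙ H
  /-- The component `J ⟶ G'HF`. -/
  c1 : J ⟶ F ⋙ H ⋙ G'
  /-- The component `F'JG ⟶ H`. -/
  c2 : G ⋙ J ⋙ F' ⟶ H
  /-- The component `JG ⟶ G'H`. -/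
  c3 : G ⋙ J ⟶ H ⋙ G'
  /-- The component `c1` is the mate of `c0` under `F' ⊣ G'`. -/
  c1_app : ∀ X, c1.app X = adj'.unit.app (J.obj X) ≫ G'.map (c0.app X)
  /-- The component `c2` is the mate of `c0` under `F ⊣ G`. -/
  c2_app : ∀ Y, c2.app Y = c0.app (G.obj Y) ≫ H.map (adj.counit.app Y)
  /-- The component `c3` is the mate of `c0` under both adjunctions. -/
  c3_app : ∀ Y, c3.app Y =
    adj'.unit.app (J.obj (G.obj Y)) ≫ G'.map (c0.app (G.obj Y) ≫ H.map (adj.counit.app Y))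

namespace AdjointSquare

section

variable {C : Type w₁} [Category.{v₁} C] {D : Type w₂} [Category.{v₂} D]
  {C' : Type w₃} [Category.{v₃} C'] {D' : Type w₄} [Category.{v₄} D']
  {F : C ⥤ D} {G : D ⥤ C} {adj : F ⊣ G} {F' : C' ⥤ D'} {G' : D' ⥤ C'} {adj' : F' ⊣ G'}
  {J : C ⥤ C'} {H : D ⥤ D'}

/-- The component `c0` is determined by the component `c1`. -/
theorem c0_of_c1 (q : AdjointSquare adj adj' J H) (X : C) :
    q.c0.app X = F'.map (q.c1.app X) ≫ adj'.counit.app (H.obj (F.obj X)) := by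
  simp [q.c1_app]

/-- The component `c0` is determined by the component `c2`. -/
theorem c0_of_c2 (q : AdjointSquare adj adj' J H) (X : C) :
    q.c0.app X = F'.map (J.map (adj.unit.app X)) ≫ q.c2.app (F.obj X) := by
  have h := q.c0.naturality (adj.unit.app X)
  simp only [Functor.comp_map] at h
  rw [q.c2_app, reassoc_of% h, ← H.map_comp]
  simp

/-- The component `c0` is determined by the component `c3`. -/
theorem c0_of_c3 (q : AdjointSquare adj adj' J H) (X : C) :
    q.c0.app X = F'.map (J.map (adj.unit.app X)) ≫ F'.map (q.c3.app (F.obj X)) ≫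
      adj'.counit.app (H.obj (F.obj X)) := by
  rw [q.c0_of_c2 X, q.c3_app, ← q.c2_app]
  simp

/-- Adjoint squares are equal if their components `c0` are. -/
@[ext]
theorem ext {q q' : AdjointSquare adj adj' J H} (h : ∀ X, q.c0.app X = q'.c0.app X) : q = q' := by
  have h0 : q.c0 = q'.c0 := NatTrans.ext (funext h)
  have h1 : q.c1 = q'.c1 := NatTrans.ext (funext fun X => by rw [q.c1_app, q'.c1_app, h0])
  have h2 : q.c2 = q'.c2 := NatTrans.ext (funext fun X => by rw [q.c2_app, q'.c2_app, h0])
  have h3 : q.c3 = q'.c3 := NatTrans.ext (funext fun X => by rw [q.c3_app, q'.c3_app, h0])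
  cases q
  cases q'
  cases h0
  cases h1
  cases h2
  cases h3
  rfl

/-- The adjoint square with a given component `c0`. -/
def ofC0 (adj : F ⊣ G) (adj' : F' ⊣ G') (c0 : J ⋙ F' ⟶ F ⋙ H) : AdjointSquare adj adj' J H where
  c0 := c0
  c1 :=
    { app := fun X => adj'.unit.app (J.obj X) ≫ G'.map (c0.app X)
      naturality := fun X Y f => by
        have h := c0.naturality f
        have h' := adj'.unit.naturality (J.map f)
        simp only [Functor.comp_map, Functor.id_map] at h h'
        rw [reassoc_of% h', ← G'.map_comp, h]
        simp }
  c2 :=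
    { app := fun Y => c0.app (G.obj Y) ≫ H.map (adj.counit.app Y)
      naturality := fun X Y f => by
        have h := c0.naturality (G.map f)
        simp only [Functor.comp_map] at h
        simp [reassoc_of% h, ← Functor.map_comp] }
  c3 :=
    { app := fun Y =>
        adj'.unit.app (J.obj (G.obj Y)) ≫ G'.map (c0.app (G.obj Y) ≫ H.map (adj.counit.app Y))
      naturality := fun X Y f => by
        have h := c0.naturality (G.map f)
        have h' := adj'.unit.naturality (J.map (G.map f))
        simp only [Functor.comp_map, Functor.id_map] at h h'
        simp only [Functor.comp_map, Category.assoc]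
        rw [reassoc_of% h', ← G'.map_comp, reassoc_of% h, ← G'.map_comp, Category.assoc,
          ← H.map_comp, ← H.map_comp, adj.counit_naturality] }
  c1_app _ := rfl
  c2_app _ := rfl
  c3_app _ := rfl

@[simp]
theorem ofC0_c0 (c0 : J ⋙ F' ⟶ F ⋙ H) : (ofC0 adj adj' c0).c0 = c0 := rfl

end

section

variable {C : Type w₁} [Category.{v₁} C] {C' : Type w₂} [Category.{v₂} C']
  {D : Type w₁} [Category.{v₁} D] {D' : Type w₂} [Category.{v₂} D']
  {E : Type w₁} [Category.{v₁} E] {E' : Type w₂} [Category.{v₂} E']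

/-- The composite of adjoint squares along the direction of the adjunctions. Its component `c0` is
the composite of `L'F'J ⟶ L'HF` and `L'HF ⟶ KLF`. -/
def adComp {F : C ⥤ D} {G : D ⥤ C} {adj : F ⊣ G} {F' : C' ⥤ D'} {G' : D' ⥤ C'} {adj' : F' ⊣ G'}
    {L : D ⥤ E} {M : E ⥤ D} {bdj : L ⊣ M} {L' : D' ⥤ E'} {M' : E' ⥤ D'} {bdj' : L' ⊣ M'}
    {J : C ⥤ C'} {H : D ⥤ D'} {K : E ⥤ E'}
    (q : AdjointSquare adj adj' J H) (r : AdjointSquare bdj bdj' H K) :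
    AdjointSquare (adj.comp bdj) (adj'.comp bdj') J K :=
  ofC0 (adj.comp bdj) (adj'.comp bdj')
    { app := fun X => L'.map (q.c0.app X) ≫ r.c0.app (F.obj X)
      naturality := fun X Y f => by
        have h := q.c0.naturality f
        have h' := r.c0.naturality (F.map f)
        simp only [Functor.comp_map] at h h'
        simp only [Functor.comp_map, Category.assoc]
        rw [← h', ← L'.map_comp_assoc, ← L'.map_comp_assoc, h] }

end

end AdjointSquare

/-- An object of the 2-category of monads: a category with a monad on it. -/
structure MndAlg : Type (max (v + 1) (w + 1)) where
  /-- The category. -/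
  carrier : Type w
  /-- Its structure. -/
  [str : Category.{v} carrier]
  /-- The monad. -/
  monad : Monad carrier

attribute [instance] MndAlg.str

/-- An alg-morphism of monads from `(C, T)` to `(C', T')`: an adjunction `L ⊣ R` from `C` to `C'` and
an adjoint square on `T` and `T'` that is compatible with the units and multiplications. -/
structure AlgMorphism (M N : MndAlg.{v, w}) : Type (max v w) where
  /-- The left adjoint. -/
  L : M.carrier ⥤ N.carrier
  /-- The right adjoint. -/
  R : N.carrier ⥤ M.carrier
  /-- The adjunction. -/
  adj : L ⊣ R
  /-- The adjoint square. -/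
  sq : AdjointSquare adj adj M.monad.toFunctor N.monad.toFunctor
  /-- The compatibility with the units. -/
  unit_comp : ∀ X, L.map (M.monad.η.app X) ≫ sq.c0.app X = N.monad.η.app (L.obj X)
  /-- The compatibility with the multiplications. -/
  mult_comp : ∀ X, L.map (M.monad.μ.app X) ≫ sq.c0.app X =
    sq.c0.app (M.monad.obj X) ≫ N.monad.map (sq.c0.app X) ≫ N.monad.μ.app (L.obj X)

namespace AlgMorphism

variable {M N P : MndAlg.{v, w}}

theorem nat (f : AlgMorphism M N) {X Y : M.carrier} (k : X ⟶ Y) :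
    f.L.map (M.monad.map k) ≫ f.sq.c0.app Y = f.sq.c0.app X ≫ N.monad.map (f.L.map k) :=
  f.sq.c0.naturality k

theorem nat_assoc (f : AlgMorphism M N) {X Y : M.carrier} (k : X ⟶ Y) {Z : N.carrier}
    (h : N.monad.obj (f.L.obj Y) ⟶ Z) :
    f.L.map (M.monad.map k) ≫ f.sq.c0.app Y ≫ h =
      f.sq.c0.app X ≫ N.monad.map (f.L.map k) ≫ h := by
  rw [← Category.assoc, f.nat k, Category.assoc]

/-- The identity alg-morphism. -/
protected def id (M : MndAlg.{v, w}) : AlgMorphism M M where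
  L := 𝟭 M.carrier
  R := 𝟭 M.carrier
  adj := Adjunction.id
  sq := AdjointSquare.ofC0 Adjunction.id Adjunction.id
    { app := fun X => 𝟙 (M.monad.obj X) }
  unit_comp X := by simp
  mult_comp X := by simp

/-- The composite of alg-morphisms. -/
protected def comp (f : AlgMorphism M N) (g : AlgMorphism N P) : AlgMorphism M P where
  L := f.L ⋙ g.L
  R := g.R ⋙ f.R
  adj := f.adj.comp g.adj
  sq := f.sq.adComp g.sq
  unit_comp X := by
    have h := congrArg (fun k => g.L.map k) (f.unit_comp X)
    simp only [Functor.map_comp] at h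
    simp only [AdjointSquare.adComp, AdjointSquare.ofC0_c0, Functor.comp_map]
    rw [reassoc_of% h, g.unit_comp]
    rfl
  mult_comp X := by
    have h := congrArg (fun k => g.L.map k) (f.mult_comp X)
    simp only [Functor.map_comp] at h
    simp only [AdjointSquare.adComp, AdjointSquare.ofC0_c0, Functor.comp_map]
    rw [reassoc_of% h, g.mult_comp, g.nat_assoc]
    simp

@[simp]
theorem id_L (M : MndAlg.{v, w}) : (AlgMorphism.id M).L = 𝟭 M.carrier := rfl

@[simp]
theorem comp_L (f : AlgMorphism M N) (g : AlgMorphism N P) : (f.comp g).L = f.L ⋙ g.L := rfl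

@[simp]
theorem id_c0 (X : M.carrier) : (AlgMorphism.id M).sq.c0.app X = 𝟙 (M.monad.obj X) := rfl

@[simp]
theorem comp_c0 (f : AlgMorphism M N) (g : AlgMorphism N P) (X : M.carrier) :
    (f.comp g).sq.c0.app X = g.L.map (f.sq.c0.app X) ≫ g.sq.c0.app (f.L.obj X) := rfl

end AlgMorphism

/-- An alg-transformation between alg-morphisms `f` and `g`: an adjoint square from the adjunction
of `f` to the adjunction of `g` with the identity at the top and the monad at the bottom, such that
the two adjoint squares `μ'(ξ λ)` and `μ'(λ' ξ)`, both with the monad of `M` at the top and the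
monad of `N` at the bottom, are equal; this is stated for the components `c0`, which determine
the squares. -/
structure AlgTransformation {M N : MndAlg.{v, w}} (f g : AlgMorphism M N) : Type (max v w) where
  /-- The adjoint square. -/
  sq : AdjointSquare f.adj g.adj (𝟭 M.carrier) N.monad.toFunctor
  /-- The compatibility with the alg-morphisms. -/
  compat : ∀ X, g.sq.c0.app X ≫ N.monad.map (sq.c0.app X) ≫ N.monad.μ.app (f.L.obj X) =
    sq.c0.app (M.monad.obj X) ≫ N.monad.map (f.sq.c0.app X) ≫ N.monad.μ.app (f.L.obj X)

namespace AlgTransformation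

variable {M N P Q : MndAlg.{v, w}}

/-- The component `c0` of an alg-transformation. -/
def app {f g : AlgMorphism M N} (ξ : AlgTransformation f g) (X : M.carrier) :
    g.L.obj X ⟶ N.monad.obj (f.L.obj X) :=
  ξ.sq.c0.app X

@[ext]
theorem ext {f g : AlgMorphism M N} {ξ χ : AlgTransformation f g} (h : ∀ X, ξ.app X = χ.app X) :
    ξ = χ := by
  have h' : ξ.sq = χ.sq := AdjointSquare.ext h
  cases ξ
  cases χ
  cases h'
  rfl

theorem nat {f g : AlgMorphism M N} (ξ : AlgTransformation f g) {X Y : M.carrier} (k : X ⟶ Y) :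
    g.L.map k ≫ ξ.app Y = ξ.app X ≫ N.monad.map (f.L.map k) :=
  ξ.sq.c0.naturality k

theorem nat_assoc {f g : AlgMorphism M N} (ξ : AlgTransformation f g) {X Y : M.carrier} (k : X ⟶ Y)
    {Z : N.carrier} (h : N.monad.obj (f.L.obj Y) ⟶ Z) :
    g.L.map k ≫ ξ.app Y ≫ h = ξ.app X ≫ N.monad.map (f.L.map k) ≫ h := by
  rw [← Category.assoc, ξ.nat k, Category.assoc]

/-- The alg-transformation with a given component `c0`. -/
def ofApp {f g : AlgMorphism M N} (a : ∀ X, g.L.obj X ⟶ N.monad.obj (f.L.obj X))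
    (nat : ∀ {X Y : M.carrier} (k : X ⟶ Y), g.L.map k ≫ a Y = a X ≫ N.monad.map (f.L.map k))
    (compat : ∀ X, g.sq.c0.app X ≫ N.monad.map (a X) ≫ N.monad.μ.app (f.L.obj X) =
      a (M.monad.obj X) ≫ N.monad.map (f.sq.c0.app X) ≫ N.monad.μ.app (f.L.obj X)) :
    AlgTransformation f g where
  sq := AdjointSquare.ofC0 f.adj g.adj
    { app := a
      naturality := fun _ _ k => nat k }
  compat := compat

@[simp]
theorem ofApp_app {f g : AlgMorphism M N} (a : ∀ X, g.L.obj X ⟶ N.monad.obj (f.L.obj X))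
    (nat : ∀ {X Y : M.carrier} (k : X ⟶ Y), g.L.map k ≫ a Y = a X ≫ N.monad.map (f.L.map k))
    (compat : ∀ X, g.sq.c0.app X ≫ N.monad.map (a X) ≫ N.monad.μ.app (f.L.obj X) =
      a (M.monad.obj X) ≫ N.monad.map (f.sq.c0.app X) ≫ N.monad.μ.app (f.L.obj X))
    (X : M.carrier) : (ofApp a nat compat).app X = a X := rfl

/-- The composite of Kleisli morphisms of the monad of `N`. -/
def kleisli {A B C : N.carrier} (a : A ⟶ N.monad.obj B) (b : B ⟶ N.monad.obj C) :
    A ⟶ N.monad.obj C :=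
  a ≫ N.monad.map b ≫ N.monad.μ.app C

/-- The action of an alg-morphism on Kleisli morphisms. -/
def extend (f : AlgMorphism M N) {A B : M.carrier} (a : A ⟶ M.monad.obj B) :
    f.L.obj A ⟶ N.monad.obj (f.L.obj B) :=
  f.L.map a ≫ f.sq.c0.app B

theorem kleisli_assoc {A B C D : N.carrier} (a : A ⟶ N.monad.obj B) (b : B ⟶ N.monad.obj C)
    (c : C ⟶ N.monad.obj D) : kleisli (kleisli a b) c = kleisli a (kleisli b c) := by
  have h := N.monad.μ.naturality c
  simp only [Functor.comp_map] at h
  simp only [kleisli, Functor.map_comp, Category.assoc]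
  rw [← reassoc_of% h, N.monad.assoc]

theorem unit_kleisli {A B : N.carrier} (a : A ⟶ N.monad.obj B) :
    kleisli (N.monad.η.app A) a = a := by
  have h := N.monad.η.naturality a
  simp only [Functor.id_map] at h
  simp only [kleisli]
  rw [← reassoc_of% h, N.monad.left_unit]
  exact Category.comp_id a

theorem kleisli_unit {A B : N.carrier} (a : A ⟶ N.monad.obj B) :
    kleisli a (N.monad.η.app B) = a := by
  simp [kleisli]

theorem precomp_kleisli {A A' B C : N.carrier} (k : A' ⟶ A) (a : A ⟶ N.monad.obj B)
    (b : B ⟶ N.monad.obj C) : kleisli (k ≫ a) b = k ≫ kleisli a b := by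
  simp [kleisli]

theorem extend_kleisli (f : AlgMorphism M N) {A B C : M.carrier} (a : A ⟶ M.monad.obj B)
    (b : B ⟶ M.monad.obj C) :
    extend f (kleisli a b) = kleisli (extend f a) (extend f b) := by
  simp only [kleisli, extend, Functor.map_comp, Category.assoc]
  rw [f.mult_comp, f.nat_assoc]

theorem extend_unit (f : AlgMorphism M N) (A : M.carrier) :
    extend f (M.monad.η.app A) = N.monad.η.app (f.L.obj A) :=
  f.unit_comp A

theorem extend_precomp (f : AlgMorphism M N) {A A' B : M.carrier} (k : A' ⟶ A)
    (a : A ⟶ M.monad.obj B) : extend f (k ≫ a) = f.L.map k ≫ extend f a := by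
  simp [extend]

theorem extend_id (f : AlgMorphism M N) (A : M.carrier) :
    extend f (𝟙 (M.monad.obj A)) = f.sq.c0.app A := by
  simp [extend]

theorem id_extend {A B : M.carrier} (a : A ⟶ M.monad.obj B) :
    extend (AlgMorphism.id M) a = a := by
  simp [extend]

theorem comp_extend (f : AlgMorphism M N) (g : AlgMorphism N P) {A B : M.carrier}
    (a : A ⟶ M.monad.obj B) : extend (f.comp g) a = extend g (extend f a) := by
  simp [extend]

theorem comp_extend_c0 (f : AlgMorphism M N) (g : AlgMorphism N P) (A : M.carrier) :
    (f.comp g).sq.c0.app A = extend g (f.sq.c0.app A) := rfl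

theorem compat_kleisli {f g : AlgMorphism M N} (ξ : AlgTransformation f g) (X : M.carrier) :
    kleisli (g.sq.c0.app X) (ξ.app X) = kleisli (ξ.app (M.monad.obj X)) (f.sq.c0.app X) :=
  ξ.compat X

theorem extend_app {f g : AlgMorphism M N} (ξ : AlgTransformation f g) {A B : M.carrier}
    (a : A ⟶ M.monad.obj B) :
    kleisli (extend g a) (ξ.app B) = kleisli (ξ.app A) (extend f a) := by
  rw [extend, precomp_kleisli, compat_kleisli, kleisli, kleisli, ξ.nat_assoc, extend]
  simp

/-- The identity alg-transformation, with component `c0` the unit of the monad. -/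
protected def id (f : AlgMorphism M N) : AlgTransformation f f :=
  ofApp (fun X => N.monad.η.app (f.L.obj X))
    (fun k => N.monad.η.naturality (f.L.map k))
    (fun X => (kleisli_unit _).trans (unit_kleisli _).symm)

/-- The vertical composite, with component `c0` the composite of `J'' ⟶ T'J'`, `T'J' ⟶ T'T'J` and
the multiplication. -/
protected def comp {f g h : AlgMorphism M N} (ξ : AlgTransformation f g)
    (χ : AlgTransformation g h) : AlgTransformation f h :=
  ofApp (fun X => χ.app X ≫ N.monad.map (ξ.app X) ≫ N.monad.μ.app (f.L.obj X))
    (fun {X Y} k => by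
      have h₁ := N.monad.μ.naturality (f.L.map k)
      simp only [Functor.comp_map] at h₁
      rw [χ.nat_assoc, ← N.monad.map_comp_assoc, ξ.nat, N.monad.map_comp_assoc, h₁]
      simp)
    (fun X => by
      change kleisli _ (kleisli _ _) = kleisli (kleisli _ _) _
      rw [← kleisli_assoc, χ.compat_kleisli, kleisli_assoc, ξ.compat_kleisli, kleisli_assoc])

/-- The horizontal composite of an alg-morphism with an alg-transformation, with component `c0`
the transformation at the values of the left adjoint. -/
def whiskerLeft (f : AlgMorphism M N) {g h : AlgMorphism N P} (χ : AlgTransformation g h) :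
    AlgTransformation (f.comp g) (f.comp h) :=
  ofApp (fun X => χ.app (f.L.obj X))
    (fun k => χ.nat (f.L.map k))
    (fun X => χ.extend_app (f.sq.c0.app X))

/-- The horizontal composite of an alg-transformation `J' ⟶ T'J` with an alg-morphism `(L, λ)`, with
component `c0` the composite of `LJ' ⟶ LT'J` and `LT'J ⟶ T''LJ`. -/
def whiskerRight {f g : AlgMorphism M N} (ξ : AlgTransformation f g) (h : AlgMorphism N P) :
    AlgTransformation (f.comp h) (g.comp h) :=
  ofApp (fun X => h.L.map (ξ.app X) ≫ h.sq.c0.app (f.L.obj X))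
    (fun {X Y} k => by
      have h₁ := congrArg (fun k => h.L.map k) (ξ.nat k)
      simp only [Functor.map_comp] at h₁
      simp only [AlgMorphism.comp_L, Functor.comp_map]
      rw [reassoc_of% h₁, h.nat]
      simp)
    (fun X => by
      change kleisli (extend h _) (extend h _) = kleisli (extend h _) (extend h _)
      rw [← extend_kleisli, ξ.compat_kleisli, extend_kleisli])

/-- The canonical alg-transformation between the two composites of three alg-morphisms, which have
the same left adjoint; its component `c0` is the unit of the monad. -/
def assoc (f : AlgMorphism M N) (g : AlgMorphism N P) (h : AlgMorphism P Q) :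
    AlgTransformation ((f.comp g).comp h) (f.comp (g.comp h)) :=
  ofApp (fun X => Q.monad.η.app (h.L.obj (g.L.obj (f.L.obj X))))
    (fun k => Q.monad.η.naturality (h.L.map (g.L.map (f.L.map k))))
    (fun X => (kleisli_unit _).trans
      (Eq.trans (by simp) (unit_kleisli (((f.comp g).comp h).sq.c0.app X)).symm))

/-- The inverse of the canonical alg-transformation between the composites. -/
def assocInv (f : AlgMorphism M N) (g : AlgMorphism N P) (h : AlgMorphism P Q) :
    AlgTransformation (f.comp (g.comp h)) ((f.comp g).comp h) :=
  ofApp (fun X => Q.monad.η.app (h.L.obj (g.L.obj (f.L.obj X))))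
    (fun k => Q.monad.η.naturality (h.L.map (g.L.map (f.L.map k))))
    (fun X => (kleisli_unit _).trans
      (Eq.trans (by simp) (unit_kleisli ((f.comp (g.comp h)).sq.c0.app X)).symm))

/-- The canonical alg-transformation for an identity on the left. -/
def leftUnit (f : AlgMorphism M N) : AlgTransformation ((AlgMorphism.id M).comp f) f :=
  ofApp (fun X => N.monad.η.app (f.L.obj X))
    (fun k => N.monad.η.naturality (f.L.map k))
    (fun X => (kleisli_unit _).trans
      (Eq.trans (by simp) (unit_kleisli (((AlgMorphism.id M).comp f).sq.c0.app X)).symm))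

/-- The inverse of the canonical alg-transformation for an identity on the left. -/
def leftUnitInv (f : AlgMorphism M N) : AlgTransformation f ((AlgMorphism.id M).comp f) :=
  ofApp (fun X => N.monad.η.app (f.L.obj X))
    (fun k => N.monad.η.naturality (f.L.map k))
    (fun X => (kleisli_unit _).trans
      (Eq.trans (by simp) (unit_kleisli (f.sq.c0.app X)).symm))

/-- The canonical alg-transformation for an identity on the right. -/
def rightUnit (f : AlgMorphism M N) : AlgTransformation (f.comp (AlgMorphism.id N)) f :=
  ofApp (fun X => N.monad.η.app (f.L.obj X))
    (fun k => N.monad.η.naturality (f.L.map k))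
    (fun X => (kleisli_unit _).trans
      (Eq.trans (by simp) (unit_kleisli ((f.comp (AlgMorphism.id N)).sq.c0.app X)).symm))

/-- The inverse of the canonical alg-transformation for an identity on the right. -/
def rightUnitInv (f : AlgMorphism M N) : AlgTransformation f (f.comp (AlgMorphism.id N)) :=
  ofApp (fun X => N.monad.η.app (f.L.obj X))
    (fun k => N.monad.η.naturality (f.L.map k))
    (fun X => (kleisli_unit _).trans
      (Eq.trans (by simp) (unit_kleisli (f.sq.c0.app X)).symm))

@[simp]
theorem id_app (f : AlgMorphism M N) (X : M.carrier) :
    (AlgTransformation.id f).app X = N.monad.η.app (f.L.obj X) := rfl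

@[simp]
theorem comp_app {f g h : AlgMorphism M N} (ξ : AlgTransformation f g)
    (χ : AlgTransformation g h) (X : M.carrier) :
    (ξ.comp χ).app X = kleisli (χ.app X) (ξ.app X) := rfl

@[simp]
theorem whiskerLeft_app (f : AlgMorphism M N) {g h : AlgMorphism N P}
    (χ : AlgTransformation g h) (X : M.carrier) :
    (χ.whiskerLeft f).app X = χ.app (f.L.obj X) := rfl

@[simp]
theorem whiskerRight_app {f g : AlgMorphism M N} (ξ : AlgTransformation f g)
    (h : AlgMorphism N P) (X : M.carrier) :
    (ξ.whiskerRight h).app X = extend h (ξ.app X) := rfl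

@[simp]
theorem assoc_app (f : AlgMorphism M N) (g : AlgMorphism N P) (h : AlgMorphism P Q)
    (X : M.carrier) :
    (assoc f g h).app X = Q.monad.η.app (h.L.obj (g.L.obj (f.L.obj X))) := rfl

@[simp]
theorem assocInv_app (f : AlgMorphism M N) (g : AlgMorphism N P) (h : AlgMorphism P Q)
    (X : M.carrier) :
    (assocInv f g h).app X = Q.monad.η.app (h.L.obj (g.L.obj (f.L.obj X))) := rfl

@[simp]
theorem leftUnit_app (f : AlgMorphism M N) (X : M.carrier) :
    (leftUnit f).app X = N.monad.η.app (f.L.obj X) := rfl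

@[simp]
theorem leftUnitInv_app (f : AlgMorphism M N) (X : M.carrier) :
    (leftUnitInv f).app X = N.monad.η.app (f.L.obj X) := rfl

@[simp]
theorem rightUnit_app (f : AlgMorphism M N) (X : M.carrier) :
    (rightUnit f).app X = N.monad.η.app (f.L.obj X) := rfl

@[simp]
theorem rightUnitInv_app (f : AlgMorphism M N) (X : M.carrier) :
    (rightUnitInv f).app X = N.monad.η.app (f.L.obj X) := rfl

end AlgTransformation

/-- Alg-morphisms and alg-transformations with vertical composition form a category. -/
instance {M N : MndAlg.{v, w}} : Category (AlgMorphism M N) where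
  Hom := AlgTransformation
  id := AlgTransformation.id
  comp := AlgTransformation.comp
  id_comp _ := AlgTransformation.ext fun _ => AlgTransformation.kleisli_unit _
  comp_id _ := AlgTransformation.ext fun _ => AlgTransformation.unit_kleisli _
  assoc _ _ _ := AlgTransformation.ext fun _ => (AlgTransformation.kleisli_assoc _ _ _).symm

/-- The 2-category of monads, alg-morphisms and alg-transformations. Its associators and unitors are
the alg-transformations whose component `c0` is the unit of the monad. -/
instance : Bicategory MndAlg.{v, w} where
  Hom := AlgMorphism
  id := AlgMorphism.id
  comp := AlgMorphism.comp
  homCategory _ _ := inferInstance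
  whiskerLeft f _ _ χ := χ.whiskerLeft f
  whiskerRight ξ h := ξ.whiskerRight h
  associator f g h :=
    { hom := AlgTransformation.assoc f g h
      inv := AlgTransformation.assocInv f g h
      hom_inv_id := AlgTransformation.ext fun _ => AlgTransformation.unit_kleisli _
      inv_hom_id := AlgTransformation.ext fun _ => AlgTransformation.unit_kleisli _ }
  leftUnitor f :=
    { hom := AlgTransformation.leftUnit f
      inv := AlgTransformation.leftUnitInv f
      hom_inv_id := AlgTransformation.ext fun _ => AlgTransformation.unit_kleisli _
      inv_hom_id := AlgTransformation.ext fun _ => AlgTransformation.unit_kleisli _ }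
  rightUnitor f :=
    { hom := AlgTransformation.rightUnit f
      inv := AlgTransformation.rightUnitInv f
      hom_inv_id := AlgTransformation.ext fun _ => AlgTransformation.unit_kleisli _
      inv_hom_id := AlgTransformation.ext fun _ => AlgTransformation.unit_kleisli _ }
  whiskerLeft_id _ _ := rfl
  whiskerLeft_comp _ _ _ _ _ _ := rfl
  id_whiskerLeft _ := AlgTransformation.ext fun _ =>
    ((AlgTransformation.kleisli_unit _).trans (AlgTransformation.unit_kleisli _)).symm
  comp_whiskerLeft _ _ _ _ _ := AlgTransformation.ext fun _ =>
    ((AlgTransformation.kleisli_unit _).trans (AlgTransformation.unit_kleisli _)).symm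
  id_whiskerRight _ g := AlgTransformation.ext fun _ => AlgTransformation.extend_unit g _
  comp_whiskerRight _ _ i := AlgTransformation.ext fun _ => AlgTransformation.extend_kleisli i _ _
  whiskerRight_id _ := AlgTransformation.ext fun _ =>
    (AlgTransformation.id_extend _).trans
    ((AlgTransformation.kleisli_unit _).trans (AlgTransformation.unit_kleisli _)).symm
  whiskerRight_comp _ g h := AlgTransformation.ext fun _ =>
    (AlgTransformation.comp_extend g h _).trans
    ((AlgTransformation.kleisli_unit _).trans (AlgTransformation.unit_kleisli _)).symm
  whisker_assoc _ _ _ _ _ := AlgTransformation.ext fun _ =>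
    ((AlgTransformation.kleisli_unit _).trans (AlgTransformation.unit_kleisli _)).symm
  whisker_exchange _ χ := AlgTransformation.ext fun _ =>
    χ.extend_app _
  pentagon _ _ _ i := AlgTransformation.ext fun _ =>
    ((congrArg (AlgTransformation.kleisli _) (AlgTransformation.extend_unit i _)).trans
      (AlgTransformation.kleisli_unit _))
  triangle _ g := AlgTransformation.ext fun _ =>
    (AlgTransformation.unit_kleisli _).trans (AlgTransformation.extend_unit g _).symm

section SortChange

variable {S T : Type u} (φ : S → List T)

/-- The `T`-sorted set that consists, at `t`, of the elements of `A` of some sort `s` together with a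
position of `φ s` at which `t` stands. -/
abbrev Coprod (A : S → Type u) (t : T) : Type u :=
  Σ s, A s × Var (φ s) t

/-- The functor from `S`-sorted sets to `T`-sorted sets that sends `A` to `Coprod φ A`. -/
def coprodFunctor : (S → Type u) ⥤ (T → Type u) where
  obj A := Coprod φ A
  map f t := ↾(fun p => ⟨p.1, f p.1 p.2.1, p.2.2⟩)

/-- The functor from `T`-sorted sets to `S`-sorted sets that sends `B` to the sorted set with,
at `s`, the families in `B` over the word `φ s`. -/
def prodFunctor : (T → Type u) ⥤ (S → Type u) where
  obj B s := Tuple B (φ s)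
  map f s := ↾(fun b t v => f t (b t v))

/-- The adjunction between the two functors. -/
def sortAdj : coprodFunctor φ ⊣ prodFunctor φ :=
  Adjunction.mkOfHomEquiv
    { homEquiv := fun _ _ =>
        { toFun := fun f s => ↾(fun a t v => f t ⟨s, a, v⟩)
          invFun := fun g t => ↾(fun p => g p.1 p.2.1 t p.2.2)
          left_inv := fun _ => rfl
          right_inv := fun _ => rfl }
      homEquiv_naturality_left_symm := fun _ _ => rfl
      homEquiv_naturality_right := fun _ _ => rfl }

theorem sortAdj_unit_apply (A : S → Type u) (s : S) (a : A s) :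
    ((sortAdj φ).unit.app A s) a = fun _ v => ⟨s, a, v⟩ := rfl

theorem sortAdj_counit_apply (B : T → Type u) (t : T) (s : S) (b : Tuple B (φ s))
    (v : Var (φ s) t) : ((sortAdj φ).counit.app B t) ⟨s, b, v⟩ = b t v := rfl

end SortChange

section Extension

variable {S T : Signature.{u}}

/-- The canonical extension to the terms over `X` of the mapping that sends an element `x` of `X` of
sort `s` to the family of the variables `⟨s, x, v⟩`. -/
def Polyderivor.extension (d : Polyderivor S T) (X : S.Srt → Type u) {s : S.Srt}
    (P : Term S X s) : Tuple (Term T (Coprod d.sort X)) (d.sort s) :=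
  P.eval (d.derived (Alg.free T (Coprod d.sort X))) (fun s x _ v => Term.var ⟨s, x, v⟩)

@[simp]
theorem Polyderivor.eval_extension (d : Polyderivor S T) (X : S.Srt → Type u) {s : S.Srt}
    (P : Term S X s) (B : Alg T) (f : ∀ t, Coprod d.sort X t → B.carrier t)
    (t : T.Srt) (v : Var (d.sort s) t) :
    (d.extension X P t v).eval B f =
      P.eval (d.derived B) (fun s x t v => f t ⟨s, x, v⟩) t v :=
  d.eval_derived_free B f _ P t v

theorem Polyderivor.extension_rename (d : Polyderivor S T) {X Y : S.Srt → Type u}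
    (f : ∀ s, X s → Y s) {s : S.Srt} (P : Term S X s) (t : T.Srt) (v : Var (d.sort s) t) :
    d.extension Y (P.rename f) t v =
      (d.extension X P t v).rename (fun _ p => ⟨p.1, f p.1 p.2.1, p.2.2⟩) :=
  Term.ext_eval fun B g => by simp

theorem Polyderivor.extension_subst (d : Polyderivor S T) {X : S.Srt → Type u} {s : S.Srt}
    (P : Term S (Term S X) s) (t : T.Srt) (v : Var (d.sort s) t) :
    d.extension X (P.subst (fun _ Q => Q)) t v =
      ((d.extension (Term S X) P t v).rename
        (fun t p => d.extension X p.2.1 t p.2.2)).subst (fun _ Q => Q) :=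
  Term.ext_eval fun B g => by
    simp only [Polyderivor.eval_extension, Term.eval_subst, Term.eval_rename]

theorem Transformation.extension_compat {d e : Polyderivor S T} (ξ : Transformation d e)
    {X : S.Srt → Type u} {s : S.Srt} (P : Term S X s) (t : T.Srt) (v : Var (e.sort s) t) :
    ((e.extension X P t v).rename (Y := Term T (Coprod d.sort X))
        (fun t p => (ξ.app p.1 t p.2.2).rename (fun _ z => ⟨p.1, p.2.1, z⟩))).subst
          (fun _ Q => Q) =
      (((ξ.app s t v).rename (Y := Coprod d.sort (Term S X))
        (fun _ z => ⟨s, P, z⟩)).rename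
          (fun t p => d.extension X p.2.1 t p.2.2)).subst (fun _ Q => Q) :=
  Term.ext_eval fun B g => by
    simp only [Polyderivor.eval_extension, Term.eval_subst, Term.eval_rename]
    exact (ξ.eval_eval B (fun s x t v => g t ⟨s, x, v⟩) P t v).symm

theorem Transformation.rename_rename {d e : Polyderivor S T} (ξ : Transformation d e)
    {X Y : S.Srt → Type u} (f : ∀ s, X s → Y s) {s : S.Srt} (x : X s) (t : T.Srt)
    (v : Var (e.sort s) t) :
    (ξ.app s t v).rename (Y := Coprod d.sort Y) (fun _ z => ⟨s, f s x, z⟩) =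
      ((ξ.app s t v).rename (Y := Coprod d.sort X) (fun _ z => ⟨s, x, z⟩)).rename
        (fun _ p => ⟨p.1, f p.1 p.2.1, p.2.2⟩) :=
  Term.ext_eval fun B g => by simp

theorem sorted_hom_ext {T : Type u} {X Y : T → Type u} {f g : X ⟶ Y}
    (h : ∀ t x, f t x = g t x) : f = g :=
  funext fun t => ConcreteCategory.hom_ext (f t) (g t) (h t)

end Extension

/-- The object of the 2-category of monads that is given by a signature: the term monad on the
category of sorted sets. -/
def termMnd (S : Signature.{u}) : MndAlg.{u, u + 1} where
  carrier := S.Srt → Type u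
  monad := termMonad S

/-- The alg-morphism that is given by a polyderivor. -/
def termMor {S T : Signature.{u}} (d : Polyderivor S T) :
    AlgMorphism (termMnd S) (termMnd T) where
  L := coprodFunctor d.sort
  R := prodFunctor d.sort
  adj := sortAdj d.sort
  sq := AdjointSquare.ofC0 (sortAdj d.sort) (sortAdj d.sort)
    { app := fun X t => ↾(fun p => d.extension X p.2.1 t p.2.2)
      naturality := fun _ _ f => sorted_hom_ext fun t p =>
        d.extension_rename (fun s x => f s x) p.2.1 t p.2.2 }
  unit_comp _ := sorted_hom_ext fun _ _ => rfl
  mult_comp _ := sorted_hom_ext fun t p => d.extension_subst p.2.1 t p.2.2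

/-- The component `c1` of the adjoint square is the canonical extension. -/
theorem termMor_c1_apply {S T : Signature.{u}} (d : Polyderivor S T) (X : S.Srt → Type u)
    (s : S.Srt) (P : Term S X s) : ((termMor d).sq.c1.app X s) P = d.extension X P := rfl

/-- The alg-transformation that is given by a transformation: its component `c0` sends `⟨s, x, v⟩` to
the term at `v` of the transformation, with every variable `z` replaced by `⟨s, x, z⟩`. -/
def termTrans {S T : Signature.{u}} {d e : Polyderivor S T} (ξ : Transformation d e) :
    AlgTransformation (termMor d) (termMor e) where
  sq := AdjointSquare.ofC0 (sortAdj d.sort) (sortAdj e.sort)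
    { app := fun X t => ↾(fun p => (ξ.app p.1 t p.2.2).rename (fun _ z => ⟨p.1, p.2.1, z⟩))
      naturality := fun _ _ f => sorted_hom_ext fun t p =>
        ξ.rename_rename (fun s x => f s x) p.2.1 t p.2.2 }
  compat _ := sorted_hom_ext fun t p => ξ.extension_compat p.2.1 t p.2.2

/-- The assignments, on objects, morphisms and 2-cells, from the 2-category of signatures to the
2-category of monads. -/
def termPrelax : PrelaxFunctorStruct Signature.{u} MndAlg.{u, u + 1} where
  obj := termMnd
  map d := termMor d
  map₂ ξ := termTrans ξ

/-! Everything rests on two facts about sorted sets: a sorted set is the coproduct of one-point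
sorted sets `Point s`, one for each of its elements, and every term contains only finitely many
variables.

On 2-cells: `Coprod d.sort (Point s)` is a copy of the variables of the word `d.sort s`. The value
of an alg-transformation at the point of `Point s` is therefore a family of terms of the kind that a
transformation has at `s`. Naturality along the maps that pick an element determines all other
values. Compatibility with the monads, tested on the generic term `σ(x₁, …, xₙ)` over the variables
of its arity, is the law of a transformation. This gives `termTrans_bijective`. Since the assignment
also respects vertical composition, isomorphisms between images of polyderivors lift to isomorphisms
of polyderivors.

Pseudo-functoriality: the left adjoints attached to the identity and to a composite differ from the
identity and from the composite only by a renaming of positions. Such natural isomorphisms, followed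
by the unit of the monad, are invertible 2-cells (`isoOfIso`), and the coherence laws become
equalities of renamings.

On equivalences: it remains to see that each half `f` of an equivalence of term monads is isomorphic
to the image of a polyderivor. Its left adjoint `F` preserves coproducts, so it is given by words as
soon as each `N = F (Point s)` is finite. One of the 2-cells supplies a single term with variables
in the other left adjoint at `N`. That term has finite support, so it comes from a finite part `A`
of `N`. By a zigzag identity the unit `N ⟶ T N` then factors through the terms over `A`, and as a
variable is not a term over anything smaller, `A` is all of `N` (`finite_of_rightZigzag`). Once `F`
is given by words, the adjoint square is a translation of terms compatible with variables and
substitution. Such a translation is determined by its values at the generic terms of the operations,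
and these are the data of a polyderivor (`exists_termMor_iso`). Finally the unit and counit lift by
the result on 2-cells. -/

/-! ### One-point sorted sets and the bijection on 2-cells -/

/-- The sorted set with exactly one element, which has the sort `s`. -/
inductive Point {S : Type u} (s : S) : S → Type u
  | mk : Point s s

/-- The sorted map from `Point s` that picks the element `x`. -/
def Point.desc {S : Type u} {X : S → Type u} {s : S} (x : X s) : Point s ⟶ X :=
  fun _ => ↾(fun | Point.mk => x)

@[simp]
theorem Point.desc_mk {S : Type u} {X : S → Type u} {s : S} (x : X s) :
    Point.desc x s Point.mk = x := rfl

namespace AlgTransformation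

variable {S T : Signature.{u}} {d e : Polyderivor S T}

/-- The values of an alg-transformation between the alg-morphisms of polyderivors. -/
def value (ζ : AlgTransformation (termMor d) (termMor e)) (X : S.Srt → Type u) {s : S.Srt}
    (x : X s) (t : T.Srt) (v : Var (e.sort s) t) : Term T (Coprod d.sort X) t :=
  (ζ.app X t) (⟨s, x, v⟩ : Coprod e.sort X t)

theorem ext_value {ζ ζ' : AlgTransformation (termMor d) (termMor e)}
    (h : ∀ (X : S.Srt → Type u) (s : S.Srt) (x : X s) (t : T.Srt) (v : Var (e.sort s) t),
      ζ.value X x t v = ζ'.value X x t v) : ζ = ζ' :=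
  AlgTransformation.ext fun X => sorted_hom_ext fun t p => h X p.1 p.2.1 t p.2.2

/-- This is naturality read on elements. Applied to `Point.desc x`, it reduces every value to a
value at a one-point sorted set. -/
theorem value_map (ζ : AlgTransformation (termMor d) (termMor e)) {X Y : S.Srt → Type u}
    (f : X ⟶ Y) {s : S.Srt} (x : X s) (t : T.Srt) (v : Var (e.sort s) t) :
    ζ.value Y (f s x) t v =
      (ζ.value X x t v).rename (fun _ p => ⟨p.1, f p.1 p.2.1, p.2.2⟩) :=
  ConcreteCategory.congr_hom (congrFun (ζ.nat (M := termMnd S) f) t) ⟨s, x, v⟩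

/-- This is the compatibility of the alg-transformation read on elements: renaming followed by the
multiplication of the term monad is a single substitution. -/
theorem value_compat (ζ : AlgTransformation (termMor d) (termMor e)) (X : S.Srt → Type u)
    {s : S.Srt} (P : Term S X s) (t : T.Srt) (v : Var (e.sort s) t) :
    (e.extension X P t v).subst (fun t p => ζ.value X p.2.1 t p.2.2) =
      (ζ.value (Term S X) P t v).subst (fun t p => d.extension X p.2.1 t p.2.2) := by
  have h := ConcreteCategory.congr_hom (congrFun (ζ.compat X) t) ⟨s, P, v⟩
  have h' : ((e.extension X P t v).rename (fun t p => ζ.value X p.2.1 t p.2.2)).subst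
        (fun _ Q => Q) =
      ((ζ.value (Term S X) P t v).rename (fun t p => d.extension X p.2.1 t p.2.2)).subst
        (fun _ Q => Q) := h
  refine Term.ext_eval fun B g => ?_
  have := congrArg (Term.eval B g) h'
  simpa only [Term.eval_subst, Term.eval_rename] using this

/-- The transformation that an alg-transformation comes from. -/
def toTransformation (ζ : AlgTransformation (termMor d) (termMor e)) : Transformation d e :=
  Transformation.ofEval
    (fun s t v => (ζ.value (Point s) Point.mk t v).rename
      (fun _ p => match p with | ⟨_, Point.mk, z⟩ => z))
    (fun B w s σ q t v => by
      -- By naturality the value at any `x` is the family at the point with `⟨s, x, z⟩` in place of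
      -- `z`, so its evaluation depends on the valuation only through the variables that belong to
      -- `x`.
      have key : ∀ {X : S.Srt → Type u} {s : S.Srt} (x : X s) (t : T.Srt) (v : Var (e.sort s) t)
          (g : ∀ t, Coprod d.sort X t → B.carrier t),
          ((ζ.value (Point s) Point.mk t v).rename
            (fun _ p => match p with | ⟨_, Point.mk, z⟩ => z)).eval B (fun t z => g t ⟨s, x, z⟩) =
          (ζ.value X x t v).eval B g := by
        intro X s x t v g
        have h := ζ.value_map (Point.desc x) Point.mk t v
        rw [Point.desc_mk] at h
        rw [h, Term.eval_rename, Term.eval_rename]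
        congr 1
        funext t p
        obtain ⟨_, ⟨⟩, z⟩ := p
        rfl
      -- Compatibility is tested on `σ` applied to the variables of its arity, evaluated at the
      -- arguments `q`. This generic instance is the law for all arguments in `B`.
      have h := congrArg (Term.eval B (fun t p => q p.1 p.2.1 t p.2.2))
        (ζ.value_compat (Var w) (Term.op σ (fun _ x => Term.var x)) t v)
      rw [Term.eval_subst, Term.eval_subst, Polyderivor.eval_extension] at h
      simp only [Polyderivor.eval_extension] at h
      rw [← key] at h
      refine h.symm.trans ?_
      simp only [Term.eval_op_apply, Term.eval_var_apply]
      congr 2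
      funext s' x t' v'
      exact (key x t' v' (fun t p => q p.1 p.2.1 t p.2.2)).symm)

end AlgTransformation

/-- The value at the point of `Point s` recovers the terms of the transformation at `s`, since `⟨s,
Point.mk, z⟩ ↦ z` is a bijection of variables. This gives injectivity; surjectivity holds because
naturality propagates these values to every sorted set. -/
theorem termTrans_bijective {S T : Signature.{u}} (d e : Polyderivor S T) :
    Function.Bijective (fun ξ : Transformation d e => termTrans ξ) := by
  constructor
  · intro ξ χ h
    refine Transformation.ext (funext fun s => funext fun t => funext fun v => ?_)
    have h' : (ξ.app s t v).rename (Y := Coprod d.sort (Point s)) (fun _ z => ⟨s, Point.mk, z⟩) =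
        (χ.app s t v).rename (fun _ z => ⟨s, Point.mk, z⟩) :=
      congrArg (fun ζ => AlgTransformation.value ζ (Point s) Point.mk t v) h
    -- The renaming that forgets the point is inverse to the one in `h'`.
    have h'' := congrArg (Term.rename (fun _ p => match p with | ⟨_, Point.mk, z⟩ => z)) h'
    refine Term.ext_eval fun B g => ?_
    simpa using congrArg (Term.eval B g) h''
  · intro ζ
    refine ⟨ζ.toTransformation, AlgTransformation.ext_value fun X s x t v => ?_⟩
    have h := ζ.value_map (Point.desc x) Point.mk t v
    rw [Point.desc_mk] at h
    rw [h]
    refine Term.ext_eval fun B g => ?_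
    change Term.eval B g (Term.rename _ (Term.rename _ _)) = _
    rw [Term.eval_rename, Term.eval_rename, Term.eval_rename]
    congr 1
    funext t p
    obtain ⟨_, ⟨⟩, z⟩ := p
    rfl

/-! ### Invertible 2-cells from isomorphisms of left adjoints -/

namespace AlgTransformation

variable {M N P : MndAlg.{v, w}}

/-- A natural transformation of left adjoints that is compatible with the adjoint squares induces an
alg-transformation. -/
def ofNatTrans {f g : AlgMorphism M N} (θ : g.L ⟶ f.L)
    (h : ∀ X, g.sq.c0.app X ≫ N.monad.map (θ.app X) = θ.app (M.monad.obj X) ≫ f.sq.c0.app X) :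
    AlgTransformation f g :=
  ofApp (fun X => θ.app X ≫ N.monad.η.app (f.L.obj X))
    (fun {X Y} k => by
      have h₁ := N.monad.η.naturality (f.L.map k)
      simp only [Functor.id_map] at h₁
      rw [θ.naturality_assoc, h₁, Category.assoc])
    (fun X => by
      change kleisli _ _ = kleisli _ _
      rw [precomp_kleisli, unit_kleisli, ← h]
      simp [kleisli])

/-- An arrow followed by the unit is the image of an ordinary arrow in the Kleisli category. The
comparison 2-cells of the pseudo-functor all have this form, and the rules below reduce composites
with them to ordinary composites. -/
theorem precomp_unit_kleisli {A A' B : N.carrier} (k : A' ⟶ A) (a : A ⟶ N.monad.obj B) :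
    kleisli (k ≫ N.monad.η.app A) a = k ≫ a := by
  rw [precomp_kleisli, unit_kleisli]

theorem kleisli_precomp_unit {A B C : N.carrier} (a : A ⟶ N.monad.obj B) (k : B ⟶ C) :
    kleisli a (k ≫ N.monad.η.app C) = a ≫ N.monad.map k := by
  simp [kleisli]

/-- An isomorphism of left adjoints that is compatible with the adjoint squares induces an isomorphism
of alg-morphisms. -/
def isoOfIso {f g : AlgMorphism M N} (θ : f.L ≅ g.L)
    (h : ∀ X, f.sq.c0.app X ≫ N.monad.map (θ.hom.app X) =
      θ.hom.app (M.monad.obj X) ≫ g.sq.c0.app X) : f ≅ g where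
  -- A 2-cell from `f` to `g` has its component `c0` on `g.L`, so its direction is opposite to that
  -- of the natural transformation of left adjoints.
  hom := ofNatTrans θ.inv (fun X => by
    rw [← cancel_epi (θ.hom.app (M.monad.obj X)), ← reassoc_of% h, ← Functor.map_comp]
    simp)
  inv := ofNatTrans θ.hom h
  hom_inv_id := AlgTransformation.ext fun X => by
    change kleisli (θ.hom.app X ≫ _) (θ.inv.app X ≫ _) = _
    rw [precomp_unit_kleisli]
    exact θ.hom_inv_id_app_assoc X _
  inv_hom_id := AlgTransformation.ext fun X => by
    change kleisli (θ.inv.app X ≫ _) (θ.hom.app X ≫ _) = _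
    rw [precomp_unit_kleisli]
    exact θ.inv_hom_id_app_assoc X _

theorem isoOfIso_hom_comp_app {f g k : AlgMorphism M N} (θ : f.L ≅ g.L)
    (h : ∀ X, f.sq.c0.app X ≫ N.monad.map (θ.hom.app X) =
      θ.hom.app (M.monad.obj X) ≫ g.sq.c0.app X) (ξ : g ⟶ k) (X : M.carrier) :
    AlgTransformation.app ((isoOfIso θ h).hom ≫ ξ) X =
      AlgTransformation.app ξ X ≫ N.monad.map (θ.inv.app X) :=
  kleisli_precomp_unit _ _

theorem comp_isoOfIso_inv_app {f g k : AlgMorphism M N} (θ : f.L ≅ g.L)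
    (h : ∀ X, f.sq.c0.app X ≫ N.monad.map (θ.hom.app X) =
      θ.hom.app (M.monad.obj X) ≫ g.sq.c0.app X) (ξ : k ⟶ g) (X : M.carrier) :
    AlgTransformation.app (ξ ≫ (isoOfIso θ h).inv) X =
      θ.hom.app X ≫ AlgTransformation.app ξ X :=
  precomp_unit_kleisli _ _

theorem comp_app_of_right {f g k : AlgMorphism M N} (ξ : AlgTransformation f g)
    (χ : AlgTransformation g k) {X : M.carrier} {a : k.L.obj X ⟶ g.L.obj X}
    (h : χ.app X = a ≫ N.monad.η.app (g.L.obj X)) : (ξ.comp χ).app X = a ≫ ξ.app X := by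
  rw [comp_app, h, precomp_unit_kleisli]

theorem extend_precomp_unit (f : AlgMorphism M N) {A B : M.carrier} (k : A ⟶ B) :
    extend f (k ≫ M.monad.η.app B) = f.L.map k ≫ N.monad.η.app (f.L.obj B) := by
  rw [extend_precomp, extend_unit]

end AlgTransformation

/-! ### Comparison isomorphisms and coherence of the pseudo-functor -/

section TermPseudofunctor

open AlgTransformation

variable {S T U V : Signature.{u}}

/-- The functor `coprodFunctor` for words of length one is the identity. -/
def coprodFunctorId (S : Type u) : coprodFunctor (fun s : S => [s]) ≅ 𝟭 (S → Type u) where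
  hom :=
    { app := fun _ _ => ↾(fun p => match p with | ⟨_, x, Var.here⟩ => x)
      naturality := fun _ _ f => sorted_hom_ext fun t p => by
        obtain ⟨s, x, v⟩ := p
        cases v with
        | there v => cases v
        | here => rfl }
  inv :=
    { app := fun _ s => ↾(fun x => ⟨s, x, Var.here⟩)
      naturality := fun _ _ _ => rfl }
  hom_inv_id := NatTrans.ext (funext fun X => sorted_hom_ext fun t p => by
    obtain ⟨s, x, v⟩ := p
    cases v with
    | there v => cases v
    | here => rfl)
  inv_hom_id := rfl

/-- The associativity bijection of `Coprod` for a composite. -/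
def Coprod.unpair {S T U : Type u} (φ : S → List T) (ψ : T → List U) {X : S → Type u} {r : U}
    (p : Coprod (fun s => (φ s).flatMap ψ) X r) : Coprod ψ (Coprod φ X) r :=
  ⟨_, ⟨p.1, p.2.1, (Var.split ψ _ p.2.2).2.1⟩, (Var.split ψ _ p.2.2).2.2⟩

/-- The inverse of the associativity bijection. -/
def Coprod.pair {S T U : Type u} (φ : S → List T) (ψ : T → List U) {X : S → Type u} {r : U}
    (p : Coprod ψ (Coprod φ X) r) : Coprod (fun s => (φ s).flatMap ψ) X r :=
  ⟨p.2.1.1, p.2.1.2.1, Var.pair ψ p.2.1.2.2 p.2.2⟩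

@[simp]
-- `Var.split` does not compute on an abstract `Var.pair`, so this is a propositional equation only.
-- The coherence proofs below bring it in by `congrArg`, after which the remaining equations hold by
-- computation or by evaluation in algebras.
theorem Coprod.unpair_pair {S T U : Type u} (φ : S → List T) (ψ : T → List U)
    {X : S → Type u} {s : S} (x : X s) {t : T} (v : Var (φ s) t) {r : U} (z : Var (ψ t) r) :
    Coprod.unpair φ ψ (X := X) ⟨s, x, Var.pair ψ v z⟩ = ⟨t, ⟨s, x, v⟩, z⟩ :=
  congrArg (fun q : Σ t', Var (φ s) t' × Var (ψ t') r =>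
      (⟨q.1, ⟨s, x, q.2.1⟩, q.2.2⟩ : Coprod ψ (Coprod φ X) r)) (Var.split_pair v z)

/-- The functor `coprodFunctor` for a composite is the composite. -/
def coprodFunctorComp {S T U : Type u} (φ : S → List T) (ψ : T → List U) :
    coprodFunctor (fun s => (φ s).flatMap ψ) ≅ coprodFunctor φ ⋙ coprodFunctor ψ where
  hom :=
    { app := fun _ _ => ↾(Coprod.unpair φ ψ)
      naturality := fun _ _ _ => rfl }
  inv :=
    { app := fun _ _ => ↾(Coprod.pair φ ψ)
      naturality := fun _ _ _ => rfl }
  hom_inv_id := NatTrans.ext (funext fun X => sorted_hom_ext fun t p => by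
    obtain ⟨s, x, v⟩ := p
    exact congrArg (fun v => (⟨s, x, v⟩ : Coprod (fun s => (φ s).flatMap ψ) X t))
      (Var.pair_split (φ s) v))
  inv_hom_id := NatTrans.ext (funext fun X => sorted_hom_ext fun t p => by
    obtain ⟨t', ⟨s, x, v⟩, z⟩ := p
    exact Coprod.unpair_pair φ ψ x v z)

/-- Under a valuation in an algebra `B` both sides become the value of `P` in the algebra derived
from `B` first along `e` and then along `d`. -/
theorem Polyderivor.extension_comp (d : Polyderivor S T) (e : Polyderivor T U)
    {X : S.Srt → Type u} {s : S.Srt} (P : Term S X s) {t : T.Srt} (x : Var (d.sort s) t)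
    {r : U.Srt} (z : Var (e.sort t) r) :
    ((d.comp e).extension X P r (Var.pair e.sort x z)).rename
        (fun _ p => Coprod.unpair d.sort e.sort p) =
      e.extension (Coprod d.sort X) (d.extension X P t x) r z := by
  refine Term.ext_eval fun B g => ?_
  rw [Term.eval_rename, Polyderivor.eval_extension, Polyderivor.eval_extension]
  refine ((d.comp e).eval_extension X P B _ r _).trans ?_
  rw [Polyderivor.eval_comp_derived]
  simp only [Coprod.unpair_pair]

/-- The identity polyderivor induces the identity. -/
def termMorId (S : Signature.{u}) : termMor (Polyderivor.id S) ≅ AlgMorphism.id (termMnd S) :=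
  isoOfIso (f := termMor (Polyderivor.id S)) (g := AlgMorphism.id (termMnd S))
    (coprodFunctorId S.Srt) (fun X => sorted_hom_ext fun t p => by
    obtain ⟨s, P, v⟩ := p
    cases v with
    | there v => cases v
    | here =>
    change ((Polyderivor.id S).extension X P t Var.here).rename
      (fun t p => (coprodFunctorId S.Srt).hom.app X t p) = P
    refine Term.ext_eval fun B g => ?_
    refine (Term.eval_rename B g _ _).trans ?_
    refine ((Polyderivor.id S).eval_extension X P B _ t _).trans ?_
    exact Polyderivor.eval_id_derived B _ P)

/-- The composite of polyderivors induces the composite. -/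
def termMorComp (d : Polyderivor S T) (e : Polyderivor T U) :
    termMor (d.comp e) ≅ (termMor d).comp (termMor e) :=
  isoOfIso (f := termMor (d.comp e)) (g := (termMor d).comp (termMor e))
    (coprodFunctorComp d.sort e.sort) (fun X => sorted_hom_ext fun t p => by
    obtain ⟨s, P, v⟩ := p
    obtain ⟨t', x, z, rfl⟩ := Var.exists_pair v
    refine Eq.trans ?_ (congrArg (((termMor d).comp (termMor e)).sq.c0.app X t)
      (Coprod.unpair_pair d.sort e.sort (X := Term S X) P x z)).symm
    exact d.extension_comp e P x z)

theorem termMorComp_hom_comp_app {d : Polyderivor S T} {e : Polyderivor T U}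
    {k : AlgMorphism (termMnd S) (termMnd U)}
    (ξ : (termMor d).comp (termMor e) ⟶ k) (X : S.Srt → Type u) :
    AlgTransformation.app ((termMorComp d e).hom ≫ ξ) X =
      AlgTransformation.app ξ X ≫
        (termMonad U).map ((coprodFunctorComp d.sort e.sort).inv.app X) :=
  isoOfIso_hom_comp_app (M := termMnd S) (N := termMnd U) _ _ ξ X

/-- The right-hand sides of both whiskering axioms have this shape, so that each axiom becomes an
equation between sorted maps. -/
theorem termMorComp_conj_app {d d' : Polyderivor S T} {e e' : Polyderivor T U}
    (ξ : (termMor d).comp (termMor e) ⟶ (termMor d').comp (termMor e')) (X : S.Srt → Type u) :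
    AlgTransformation.app ((termMorComp d e).hom ≫ ξ ≫ (termMorComp d' e').inv) X =
      (coprodFunctorComp d'.sort e'.sort).hom.app X ≫ AlgTransformation.app ξ X ≫
        (termMonad U).map ((coprodFunctorComp d.sort e.sort).inv.app X) := by
  refine (termMorComp_hom_comp_app _ X).trans ?_
  exact congrArg (fun k => k ≫ (termMonad U).map ((coprodFunctorComp d.sort e.sort).inv.app X))
    (comp_isoOfIso_inv_app (M := termMnd S) (N := termMnd U) _ _ ξ X)

/-- The pseudo-functor from signatures to monads. -/
def termPseudofunctor : Pseudofunctor Signature.{u} MndAlg.{u, u + 1} where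
  toPrelaxFunctorStruct := termPrelax
  map₂_id {S T} d := AlgTransformation.ext fun X => sorted_hom_ext fun t p => rfl
  map₂_comp {S T d e f} ξ χ := AlgTransformation.ext fun X => sorted_hom_ext fun t p => by
    obtain ⟨s, x, v⟩ := p
    change ((χ.app s t v).subst (ξ.app s)).rename (Y := Coprod d.sort X) (fun _ z => ⟨s, x, z⟩) =
      (((χ.app s t v).rename (Y := Coprod e.sort X) (fun _ z => ⟨s, x, z⟩)).rename
        (fun t p => (ξ.app p.1 t p.2.2).rename (Y := Coprod d.sort X)
          (fun _ z => ⟨p.1, p.2.1, z⟩))).subst (fun _ Q => Q)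
    exact Term.ext_eval fun B g => by simp
  mapId S := termMorId S
  mapComp d e := termMorComp d e
  map₂_whisker_left {S T U} d e f χ := AlgTransformation.ext fun X => by
    refine Eq.trans ?_ (termMorComp_conj_app _ X).symm
    refine sorted_hom_ext fun r p => ?_
    obtain ⟨s, x, v⟩ := p
    obtain ⟨t, y, z, rfl⟩ := Var.exists_pair v
    -- The right-hand side depends on the element only through `Coprod.unpair`, which is known at a
    -- paired position.
    refine Eq.trans ?_ (congrArg (fun p : Coprod f.sort (Coprod d.sort X) r =>
      ((termTrans χ).value (Coprod d.sort X) p.2.1 r p.2.2).rename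
        (fun _ p => Coprod.pair d.sort e.sort p)) (Coprod.unpair_pair d.sort f.sort x y z)).symm
    change ((χ.whiskerLeft d).app s r (Var.pair f.sort y z)).rename
      (Y := Coprod (d.comp e).sort X) (fun _ z => ⟨s, x, z⟩) =
      ((χ.app t r z).rename (Y := Coprod e.sort (Coprod d.sort X))
        (fun _ z => ⟨t, ⟨s, x, y⟩, z⟩)).rename (fun _ p => Coprod.pair d.sort e.sort p)
    exact Term.ext_eval fun B g => by simp [Coprod.pair]
  map₂_whisker_right {S T U d e} ξ f := AlgTransformation.ext fun X => by
    refine Eq.trans ?_ (termMorComp_conj_app _ X).symm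
    refine sorted_hom_ext fun r p => ?_
    obtain ⟨s, x, v⟩ := p
    obtain ⟨t, y, z, rfl⟩ := Var.exists_pair v
    refine Eq.trans ?_ (congrArg (fun p : Coprod f.sort (Coprod e.sort X) r =>
      (f.extension (Coprod d.sort X) ((termTrans ξ).value X p.2.1.2.1 p.1 p.2.1.2.2) r p.2.2).rename
        (fun _ p => Coprod.pair d.sort f.sort p)) (Coprod.unpair_pair e.sort f.sort x y z)).symm
    change ((ξ.whiskerRight f).app s r (Var.pair f.sort y z)).rename
      (Y := Coprod (d.comp f).sort X) (fun _ z => ⟨s, x, z⟩) =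
      (f.extension (Coprod d.sort X) ((ξ.app s t y).rename (Y := Coprod d.sort X)
        (fun _ z => ⟨s, x, z⟩)) r z).rename (fun _ p => Coprod.pair d.sort f.sort p)
    exact Term.ext_eval fun B g => by simp [Coprod.pair]
  map₂_associator {S T U V} d e f := AlgTransformation.ext fun X => by
    refine Eq.trans ?_ (termMorComp_hom_comp_app _ X).symm
    -- Every factor of the coherence 2-cell is a renaming followed by the unit. The equations `h₁`,
    -- `h₂`, `h₃` collect the factors from the right into one renaming followed by the unit.
    have h₁ : (((termMorComp e f).inv.whiskerLeft (termMor d)).comp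
        (termMorComp d (e.comp f)).inv).app X =
        ((coprodFunctorComp d.sort (e.comp f).sort).hom.app X ≫
          (coprodFunctorComp e.sort f.sort).hom.app (Coprod d.sort X)) ≫ (termMonad V).η.app _ :=
      comp_app_of_right (M := termMnd S) (N := termMnd V) _ _ rfl
    have h₂ : (AlgTransformation.comp (assoc (termMor d) (termMor e) (termMor f))
        (((termMorComp e f).inv.whiskerLeft (termMor d)).comp
          (termMorComp d (e.comp f)).inv)).app X =
        ((coprodFunctorComp d.sort (e.comp f).sort).hom.app X ≫
          (coprodFunctorComp e.sort f.sort).hom.app (Coprod d.sort X)) ≫ (termMonad V).η.app _ :=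
      comp_app_of_right (M := termMnd S) (N := termMnd V) _ _ h₁
    have h₃ : (AlgTransformation.comp ((termMorComp d e).hom.whiskerRight (termMor f))
        (AlgTransformation.comp (assoc (termMor d) (termMor e) (termMor f))
          (((termMorComp e f).inv.whiskerLeft (termMor d)).comp
            (termMorComp d (e.comp f)).inv))).app X =
        ((coprodFunctorComp d.sort (e.comp f).sort).hom.app X ≫
          (coprodFunctorComp e.sort f.sort).hom.app (Coprod d.sort X)) ≫
            (coprodFunctor f.sort).map ((coprodFunctorComp d.sort e.sort).inv.app X) ≫
              (termMonad V).η.app _ :=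
      (comp_app_of_right (M := termMnd S) (N := termMnd V) _ _ h₂).trans
        (congrArg (fun k => ((coprodFunctorComp d.sort (e.comp f).sort).hom.app X ≫
          (coprodFunctorComp e.sort f.sort).hom.app (Coprod d.sort X)) ≫ k)
          (extend_precomp_unit (M := termMnd U) (N := termMnd V) (termMor f) _))
    refine Eq.trans ?_ (congrArg (fun k => k ≫ (termMonad V).map
      ((coprodFunctorComp (d.comp e).sort f.sort).inv.app X)) h₃).symm
    refine sorted_hom_ext fun r p => ?_
    obtain ⟨s, a, p⟩ := p
    obtain ⟨t, x, p, rfl⟩ := Var.exists_pair (φ := (e.comp f).sort) p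
    obtain ⟨t', y, z, rfl⟩ := Var.exists_pair p
    -- The two unpairings are resolved one after the other; then both sides are the same variable.
    refine Eq.trans ?_ (congrArg (fun p : Coprod (e.comp f).sort (Coprod d.sort X) r =>
      (Term.var (Coprod.pair (d.comp e).sort f.sort (⟨_, Coprod.pair d.sort e.sort
        (Coprod.unpair e.sort f.sort p).2.1, (Coprod.unpair e.sort f.sort p).2.2⟩ :
          Coprod f.sort (Coprod (d.comp e).sort X) r)) :
        Term V (Coprod ((d.comp e).comp f).sort X) r))
      (Coprod.unpair_pair d.sort (e.comp f).sort a x (Var.pair f.sort y z))).symm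
    refine Eq.trans ?_ (congrArg (fun p : Coprod f.sort (Coprod e.sort (Coprod d.sort X)) r =>
      (Term.var (Coprod.pair (d.comp e).sort f.sort (⟨_, Coprod.pair d.sort e.sort p.2.1, p.2.2⟩ :
          Coprod f.sort (Coprod (d.comp e).sort X) r)) :
        Term V (Coprod ((d.comp e).comp f).sort X) r))
      (Coprod.unpair_pair e.sort f.sort (X := Coprod d.sort X) ⟨s, a, x⟩ y z)).symm
    exact congrArg (Term.rename (fun _ z => (⟨s, a, z⟩ : Coprod ((d.comp e).comp f).sort X _)))
      (Transformation.assoc_app d e f x y z)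
  map₂_left_unitor {S T} d := AlgTransformation.ext fun X => by
    refine Eq.trans ?_ (termMorComp_hom_comp_app _ X).symm
    have h : (AlgTransformation.comp ((termMorId S).hom.whiskerRight (termMor d))
        (AlgTransformation.leftUnit (termMor d))).app X =
        (coprodFunctor d.sort).map ((coprodFunctorId S.Srt).inv.app X) ≫
          (termMonad T).η.app _ :=
      (unit_kleisli (N := termMnd T) _).trans
        (extend_precomp_unit (M := termMnd S) (N := termMnd T) (termMor d) _)
    -- No unpairing of positions occurs here: both sides send `⟨s, x, v⟩` to the variable `⟨s, x,
    -- Var.pair d.sort Var.here v⟩` by computation.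
    exact (congrArg (fun k => k ≫ (termMonad T).map
      ((coprodFunctorComp (Polyderivor.id S).sort d.sort).inv.app X)) h).symm
  map₂_right_unitor {S T} d := AlgTransformation.ext fun X => by
    refine Eq.trans ?_ (termMorComp_hom_comp_app _ X).symm
    have h : (AlgTransformation.comp ((termMorId T).hom.whiskerLeft (termMor d))
        (AlgTransformation.rightUnit (termMor d))).app X =
        (coprodFunctorId T.Srt).inv.app (Coprod d.sort X) ≫ (termMonad T).η.app _ :=
      unit_kleisli (N := termMnd T) _
    exact (congrArg (fun k => k ≫ (termMonad T).map
      ((coprodFunctorComp d.sort (Polyderivor.id T).sort).inv.app X)) h).symm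

end TermPseudofunctor

/-! ### Left adjoints between categories of sorted sets -/

section LeftAdjoint

variable {S T : Type u} {L : (S → Type u) ⥤ (T → Type u)} {R : (T → Type u) ⥤ (S → Type u)}

/-- Maps from the value of a left adjoint are determined by their restrictions to the values at the
sorted sets with one element. -/
theorem left_adjoint_hom_ext (adj : L ⊣ R) {X : S → Type u} {B : T → Type u}
    {h k : L.obj X ⟶ B}
    (H : ∀ s (x : X s), L.map (Point.desc x) ≫ h = L.map (Point.desc x) ≫ k) : h = k := by
  -- After transposition the maps start at `X` itself and may be compared on elements.
  refine (adj.homEquiv X B).injective (sorted_hom_ext fun s x => ?_)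
  have := congrArg (adj.homEquiv (Point s) B) (H s x)
  rw [adj.homEquiv_naturality_left, adj.homEquiv_naturality_left] at this
  have h' : Point.desc x ≫ adj.homEquiv X B h = Point.desc x ≫ adj.homEquiv X B k := this
  exact congrArg (fun a : Point s ⟶ R.obj B => a s Point.mk) h'

/-- The map from the value of a left adjoint that is given by its restrictions to the values at the
sorted sets with one element. -/
def leftAdjointDesc (adj : L ⊣ R) {X : S → Type u} {B : T → Type u}
    (j : ∀ s, X s → (L.obj (Point s) ⟶ B)) : L.obj X ⟶ B :=
  (adj.homEquiv X B).symm (fun s => ↾(fun x => adj.homEquiv (Point s) B (j s x) s Point.mk))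

/-- Together with `left_adjoint_hom_ext`, this exhibits `L.obj X` as the coproduct of the `L.obj
(Point s)` over the elements of `X`. -/
theorem map_desc_leftAdjointDesc (adj : L ⊣ R) {X : S → Type u} {B : T → Type u}
    (j : ∀ s, X s → (L.obj (Point s) ⟶ B)) {s : S} (x : X s) :
    L.map (Point.desc x) ≫ leftAdjointDesc adj j = j s x := by
  refine (adj.homEquiv (Point s) B).injective ?_
  rw [adj.homEquiv_naturality_left, leftAdjointDesc, Equiv.apply_symm_apply]
  refine sorted_hom_ext fun s' y => ?_
  cases y
  rfl

/-- A left adjoint whose values at the sorted sets with one element are given by words is the functor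
`coprodFunctor`. -/
def coprodFunctorIso (adj : L ⊣ R) (φ : S → List T)
    (ε : ∀ s t, Var (φ s) t ≃ L.obj (Point s) t) : coprodFunctor φ ≅ L where
  hom :=
    { app := fun _ t => ↾(fun p => L.map (Point.desc p.2.1) t (ε p.1 t p.2.2))
      naturality := fun X Y f => sorted_hom_ext fun t p => by
        obtain ⟨s, x, v⟩ := p
        have h : Point.desc (f s x) = Point.desc x ≫ f :=
          sorted_hom_ext fun s' y => by cases y; rfl
        change L.map (Point.desc (f s x)) t (ε s t v) = L.map f t (L.map (Point.desc x) t (ε s t v))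
        rw [h, L.map_comp]
        rfl }
  inv :=
    { app := fun X => leftAdjointDesc adj
        (fun s x t => ↾(fun n => (⟨s, x, (ε s t).symm n⟩ : Coprod φ X t)))
      naturality := fun X Y f => left_adjoint_hom_ext adj fun s x => by
        have h : Point.desc x ≫ f = Point.desc (f s x) :=
          sorted_hom_ext fun s' y => by cases y; rfl
        rw [← Category.assoc, ← L.map_comp, h, map_desc_leftAdjointDesc, ← Category.assoc,
          map_desc_leftAdjointDesc]
        rfl }
  hom_inv_id := NatTrans.ext (funext fun X => sorted_hom_ext fun t p => by
    obtain ⟨s, x, v⟩ := p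
    refine (ConcreteCategory.congr_hom (congrFun
      (map_desc_leftAdjointDesc adj (X := X) (B := Coprod φ X)
      (fun s x t => ↾(fun n => ⟨s, x, (ε s t).symm n⟩)) x) t) (ε s t v)).trans ?_
    exact congrArg (fun v => (⟨s, x, v⟩ : Coprod φ X t)) ((ε s t).symm_apply_apply v))
  inv_hom_id := NatTrans.ext (funext fun X => left_adjoint_hom_ext adj fun s x => by
    change L.map (Point.desc x) ≫ leftAdjointDesc adj _ ≫ _ = _
    rw [← Category.assoc, map_desc_leftAdjointDesc]
    refine sorted_hom_ext fun t n => ?_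
    exact congrArg (L.map (Point.desc x) t) ((ε s t).apply_symm_apply n))

/-- Every element of a value of a left adjoint comes from a sorted set with one element. -/
theorem exists_map_desc (adj : L ⊣ R) {X : S → Type u} {t : T} (y : L.obj X t) :
    ∃ (s : S) (x : X s) (n : L.obj (Point s) t), L.map (Point.desc x) t n = y := by
  -- `B` is the joint image of the values at one-point sets. The restrictions of `L.map` factor
  -- through `B` and assemble to a section of its inclusion, so `B` is everything.
  let B : T → Type u := fun t =>
    {y : L.obj X t // ∃ (s : S) (x : X s) (n : L.obj (Point s) t), L.map (Point.desc x) t n = y}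
  let i : B ⟶ L.obj X := fun t => ↾Subtype.val
  let k : L.obj X ⟶ B := leftAdjointDesc adj
    (fun s x t => ↾(fun n => ⟨L.map (Point.desc x) t n, s, x, n, rfl⟩))
  have h : k ≫ i = 𝟙 _ := left_adjoint_hom_ext adj fun s x => by
    rw [← Category.assoc, map_desc_leftAdjointDesc]
    rfl
  have h' : (k t y : B t).1 = y := congrArg (fun a : L.obj X ⟶ L.obj X => a t y) h
  exact h' ▸ (k t y : B t).2

end LeftAdjoint

/-! ### Transport of an alg-morphism along an isomorphism of left adjoints -/

namespace AlgMorphism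

variable {M N : MndAlg.{v, w}} (f : AlgMorphism M N) {L : M.carrier ⥤ N.carrier}
  {R : N.carrier ⥤ M.carrier} (adj : L ⊣ R) (θ : L ≅ f.L)

/-- The alg-morphism with the left adjoint replaced by an isomorphic one. -/
def transport : AlgMorphism M N where
  L := L
  R := R
  adj := adj
  -- Only `c0` has to be conjugated by `θ`; the right adjoint enters the square solely through the
  -- mates of `c0`.
  sq := AdjointSquare.ofC0 adj adj
    { app := fun X => θ.hom.app _ ≫ f.sq.c0.app X ≫ N.monad.map (θ.inv.app X)
      naturality := fun X Y k => by
        have h := θ.hom.naturality (M.monad.map k)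
        simp only [Functor.comp_map, Category.assoc]
        rw [reassoc_of% h, f.nat_assoc, ← Functor.map_comp, ← Functor.map_comp,
          θ.inv.naturality] }
  unit_comp X := by
    have h := f.unit_comp X
    have h' := N.monad.η.naturality (θ.inv.app X)
    simp only [Functor.id_map] at h'
    simp only [AdjointSquare.ofC0_c0]
    have h₂ := θ.hom.naturality (M.monad.η.app X)
    simp only [Functor.id_obj] at h₂
    rw [reassoc_of% h₂, reassoc_of% h, ← h']
    simp
  mult_comp X := by
    have h := f.mult_comp X
    have h' := N.monad.μ.naturality (θ.inv.app X)
    simp only [Functor.comp_map] at h'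
    simp only [AdjointSquare.ofC0_c0]
    have h₂ := θ.hom.naturality (M.monad.μ.app X)
    simp only [Functor.comp_obj] at h₂
    rw [reassoc_of% h₂, reassoc_of% h, ← h']
    simp only [Category.assoc, ← Functor.map_comp_assoc]
    simp

/-- Replacing the left adjoint by an isomorphic one gives an isomorphic alg-morphism. -/
def transportIso : f.transport adj θ ≅ f :=
  AlgTransformation.isoOfIso (f := f.transport adj θ) (g := f) θ (fun X => by
    change (θ.hom.app _ ≫ f.sq.c0.app X ≫ N.monad.map (θ.inv.app X)) ≫
      N.monad.map (θ.hom.app X) = _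
    rw [Category.assoc, Category.assoc, ← Functor.map_comp]
    simp
    rfl)

end AlgMorphism

/-! ### Alg-morphisms whose left adjoint is given by words -/

section Represent

variable {S T : Signature.{u}}

/-- The polyderivor that is given by the values at formal operations of a translation of terms. -/
def Polyderivor.ofTranslation (φ : S.Srt → List T.Srt)
    (c : ∀ (X : S.Srt → Type u) {s : S.Srt}, Term S X s → Tuple (Term T (Coprod φ X)) (φ s)) :
    Polyderivor S T where
  sort := φ
  op {w _} σ t v := (c (Var w) (Term.op σ fun _ x => Term.var x) t v).rename
    (fun _ p => Var.pair φ p.2.1 p.2.2)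

/-- A compound term is the generic term of its operation with the arguments substituted for the
variables. By induction, a translation that respects variables and substitution is thus determined
by its values at generic terms, and these define the polyderivor. -/
theorem Polyderivor.extension_ofTranslation (φ : S.Srt → List T.Srt)
    (c : ∀ (X : S.Srt → Type u) {s : S.Srt}, Term S X s → Tuple (Term T (Coprod φ X)) (φ s))
    (c_var : ∀ (X : S.Srt → Type u) {s : S.Srt} (x : X s) (t : T.Srt) (v : Var (φ s) t),
      c X (Term.var x) t v = Term.var ⟨s, x, v⟩)
    (c_subst : ∀ {X Y : S.Srt → Type u} (g : ∀ s, X s → Term S Y s) {s : S.Srt} (P : Term S X s)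
      (t : T.Srt) (v : Var (φ s) t),
      c Y (P.subst g) t v = (c X P t v).subst (fun t p => c Y (g p.1 p.2.1) t p.2.2))
    (X : S.Srt → Type u) {s : S.Srt} (P : Term S X s) :
    (Polyderivor.ofTranslation φ c).extension X P = c X P := by
  induction P with
  | var x => exact funext fun t => funext fun v => (c_var X x t v).symm
  | @op w s σ args ih =>
    funext t v
    have h := c_subst args (Term.op σ fun _ x => Term.var x) t v
    refine Eq.trans ?_ h.symm
    refine Term.ext_eval fun B g => ?_
    refine Eq.trans ?_ (Term.eval_subst B g _ _).symm
    refine ((Polyderivor.ofTranslation φ c).eval_extension X _ B g t v).trans ?_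
    refine (Term.eval_rename B _ _ _).trans ?_
    congr 1
    funext t' p
    obtain ⟨s', x, z⟩ := p
    refine (Tuple.flat_pair (Polyderivor.ofTranslation φ c).sort _ x z).trans ?_
    refine ((Polyderivor.ofTranslation φ c).eval_extension X (args s' x) B g t' z).symm.trans ?_
    rw [ih]

open AlgTransformation in
/-- An alg-morphism whose left adjoint is given by words comes from a polyderivor. -/
theorem exists_termMor_iso (f : AlgMorphism (termMnd S) (termMnd T)) (φ : S.Srt → List T.Srt)
    (θ : coprodFunctor φ ≅ f.L) : ∃ d : Polyderivor S T, Nonempty (termMor d ≅ f) := by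
  let f' : AlgMorphism (termMnd S) (termMnd T) := f.transport (sortAdj φ) θ
  let c' : ∀ {A B : S.Srt → Type u} (_ : A ⟶ (termMonad S).obj B),
      (Coprod φ A : T.Srt → Type u) ⟶ (termMonad T).obj (Coprod φ B) := fun a =>
    extend (M := termMnd S) f' a
  -- The translation `c` is the component `c0` of `f'` on elements, written as the action of `f'` on
  -- the Kleisli arrow that is the identity of the set of terms.
  let c : ∀ (X : S.Srt → Type u) {s : S.Srt}, Term S X s → Tuple (Term T (Coprod φ X)) (φ s) :=
    fun X s P t v => c' (𝟙 ((termMonad S).obj X)) t (⟨s, P, v⟩ : Coprod φ (Term S X) t)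
  have c_apply : ∀ {A B : S.Srt → Type u} (a : A ⟶ (termMonad S).obj B) {s : S.Srt} (x : A s)
      (t : T.Srt) (v : Var (φ s) t),
      c' a t (⟨s, x, v⟩ : Coprod φ A t) = c B (a s x) t v := fun {A B} a s x t v => by
    have h : c' a = (coprodFunctor φ).map a ≫ c' (𝟙 ((termMonad S).obj B)) := by
      have h := extend_precomp (M := termMnd S) f' a (𝟙 ((termMonad S).obj B))
      exact (congrArg c' (Category.comp_id a)).symm.trans h
    exact congrArg (fun k : (Coprod φ A : T.Srt → Type u) ⟶ (termMonad T).obj (Coprod φ B) =>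
      k t (⟨s, x, v⟩ : Coprod φ A t)) h
  -- An alg-morphism acts functorially on Kleisli arrows. Preservation of units gives compatibility
  -- with variables, and preservation of composites gives compatibility with substitution.
  have c_var : ∀ (X : S.Srt → Type u) {s : S.Srt} (x : X s) (t : T.Srt) (v : Var (φ s) t),
      c X (Term.var x) t v = Term.var ⟨s, x, v⟩ := fun X s x t v =>
    (c_apply ((termMonad S).η.app X) x t v).symm.trans
      (congrArg (fun k : (Coprod φ X : T.Srt → Type u) ⟶ (termMonad T).obj (Coprod φ X) =>
        k t (⟨s, x, v⟩ : Coprod φ X t)) (extend_unit (M := termMnd S) f' X))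
  have c_subst : ∀ {X Y : S.Srt → Type u} (g : ∀ s, X s → Term S Y s) {s : S.Srt} (P : Term S X s)
      (t : T.Srt) (v : Var (φ s) t),
      c Y (P.subst g) t v = (c X P t v).subst (fun t p => c Y (g p.1 p.2.1) t p.2.2) :=
      fun {X Y} g s P t v => by
    let g' : X ⟶ (termMonad S).obj Y := fun s => ↾(g s)
    have h := congrArg (fun k : (Coprod φ (Term S X) : T.Srt → Type u) ⟶
        (termMonad T).obj (Coprod φ Y) => k t (⟨s, P, v⟩ : Coprod φ (Term S X) t))
      (extend_kleisli (M := termMnd S) f' (𝟙 ((termMonad S).obj X)) g')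
    have h₁ : P.subst g = (P.rename g).subst (fun _ Q => Q) := Term.ext_eval fun B k => by simp
    have h₂ := c_apply (kleisli (N := termMnd S) (𝟙 ((termMonad S).obj X)) g') P t v
    rw [h₁]
    refine (h₂.symm.trans h).trans ?_
    refine Term.ext_eval fun B k => ?_
    refine (Term.eval_subst B k _ _).trans ?_
    refine (Term.eval_rename B _ _ _).trans ?_
    rw [Term.eval_subst]
    congr 1
  refine ⟨Polyderivor.ofTranslation φ c, ⟨?_ ≪≫ f.transportIso (sortAdj φ) θ⟩⟩
  refine isoOfIso (f := termMor (Polyderivor.ofTranslation φ c)) (g := f')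
    (Iso.refl (coprodFunctor φ)) fun X => ?_
  have h : (termMor (Polyderivor.ofTranslation φ c)).sq.c0.app X = f'.sq.c0.app X :=
    sorted_hom_ext fun t p => (congrFun (congrFun
      (Polyderivor.extension_ofTranslation φ c c_var c_subst X p.2.1) t) p.2.2).trans
      (congrArg (fun k : (Coprod φ (Term S X) : T.Srt → Type u) ⟶
        (termMonad T).obj (Coprod φ X) => k t p) (extend_id (M := termMnd S) f' X))
  exact (congrArg (fun k => (termMor (Polyderivor.ofTranslation φ c)).sq.c0.app X ≫ k)
    ((termMonad T).map_id _)).trans (h.trans (Category.id_comp (f'.sq.c0.app X)).symm)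

end Represent

/-! ### Finiteness of the values at one-point sorted sets -/

/-- A word has finitely many variables. -/
instance Var.finite_sigma {T : Type u} (w : List T) : Finite (Σ t, Var w t) :=
  Finite.of_injective (fun p : Σ t, Var w t => p.2.pos) (by
    rintro ⟨t, v⟩ ⟨t', v'⟩ h
    have h₁ : v.pos = v'.pos := h
    -- The position alone already determines the sort of a variable.
    obtain rfl : t = t' := by rw [← v.get_pos, ← v'.get_pos, h₁]
    rw [Var.pos_injective h₁])

/-- The sorted subset that is given by a set of elements. -/
abbrev SortedSubset {T : Type u} {N : T → Type u} (A : Set (Σ t, N t)) (t : T) : Type u :=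
  {n : N t // (⟨t, n⟩ : Σ t, N t) ∈ A}

namespace SortedSubset

variable {T : Type u} {N : T → Type u}

/-- The inclusion of a sorted subset. -/
def incl (A : Set (Σ t, N t)) : (SortedSubset A : T → Type u) ⟶ N := fun _ => ↾Subtype.val

/-- The inclusion between sorted subsets. -/
def mono {A B : Set (Σ t, N t)} (h : A ⊆ B) :
    (SortedSubset A : T → Type u) ⟶ (SortedSubset B : T → Type u) :=
  fun _ => ↾(fun n => ⟨n.1, h n.2⟩)

end SortedSubset

/-- Terms whose variables come from a left adjoint functor involve finitely many elements of its
argument. -/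
theorem Term.exists_finite_support {S : Signature.{u}} {T : Type u}
    {L : (T → Type u) ⥤ (S.Srt → Type u)} {R : (S.Srt → Type u) ⥤ (T → Type u)} (adj : L ⊣ R)
    {N : T → Type u} {s : S.Srt} (P : Term S (L.obj N) s) :
    ∃ A : Set (Σ t, N t), A.Finite ∧ ∃ Q : Term S (L.obj (SortedSubset A)) s,
      Q.rename (fun s y => L.map (SortedSubset.incl A) s y) = P := by
  induction P with
  | @var s y =>
    -- A single variable already comes from one element of `N`, so a singleton supports it.
    obtain ⟨t, n, m, rfl⟩ := exists_map_desc adj y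
    refine ⟨{⟨t, n⟩}, Set.finite_singleton _,
      Term.var (L.map (Point.desc ⟨n, rfl⟩) s m), ?_⟩
    have h : Point.desc n = Point.desc (X := SortedSubset {⟨t, n⟩}) ⟨n, rfl⟩ ≫
        SortedSubset.incl {⟨t, n⟩} := sorted_hom_ext fun s' y => by cases y; rfl
    have h' : L.map (Point.desc n) s m = L.map (SortedSubset.incl {⟨t, n⟩}) s
        (L.map (Point.desc (X := SortedSubset {⟨t, n⟩}) ⟨n, rfl⟩) s m) := by
      rw [h, L.map_comp]
      rfl
    exact congrArg Term.var h'.symm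
  | @op w s σ args ih =>
    choose A hA Q hQ using ih
    -- The union of the supports of the arguments is finite because the arity is a word.
    refine ⟨⋃ p : Σ t, Var w t, A p.1 p.2, Set.finite_iUnion fun p => hA p.1 p.2,
      Term.op σ (fun t v => (Q t v).rename (fun s y => L.map (SortedSubset.mono
        (Set.subset_iUnion (fun p : Σ t, Var w t => A p.1 p.2) ⟨t, v⟩)) s y)), ?_⟩
    refine congrArg (Term.op σ) (funext fun t => funext fun v => ?_)
    rw [← hQ t v]
    refine Term.ext_eval fun B g => ?_
    refine (Term.eval_rename B _ _ _).trans ?_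
    rw [Term.eval_rename, Term.eval_rename]
    congr 1
    funext s' y
    have h := congrArg (fun k : L.obj (SortedSubset (A t v)) ⟶ L.obj N => k s' y)
      (L.map_comp (SortedSubset.mono (Set.subset_iUnion (fun p : Σ t, Var w t => A p.1 p.2)
        ⟨t, v⟩)) (SortedSubset.incl _))
    exact congrArg (g s') h.symm

/-- Naturality of the adjoint square of `f`, of `b` and of the multiplication moves `i` to the
outside. With `i` the inclusion of a finite part, this factors a zigzag composite through the terms
over that part. -/
theorem AlgTransformation.kleisli_extend_map {M N : MndAlg.{v, w}} (f : AlgMorphism M N)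
    (g : AlgMorphism N M) (b : ∀ B, f.L.obj (g.L.obj B) ⟶ N.monad.obj B)
    (hb : ∀ {B B'} (i : B ⟶ B'), f.L.map (g.L.map i) ≫ b B' = b B ≫ N.monad.map i)
    {X : M.carrier} {B B' : N.carrier} (a : X ⟶ M.monad.obj (g.L.obj B)) (i : B ⟶ B') :
    kleisli (extend f (a ≫ M.monad.map (g.L.map i))) (b B') =
      kleisli (extend f a) (b B) ≫ N.monad.map i := by
  have h := N.monad.μ.naturality i
  simp only [Functor.comp_map] at h
  simp only [kleisli, extend, Functor.map_comp, Category.assoc]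
  rw [f.nat_assoc, ← Functor.map_comp_assoc, hb, Functor.map_comp_assoc, h]

open AlgTransformation in
/-- The left adjoint of an alg-morphism between term monads that satisfies a zigzag identity has
finite values at the sorted sets with one element. -/
theorem finite_of_rightZigzag {S T : Signature.{u}} (f : termMnd S ⟶ termMnd T)
    (g : termMnd T ⟶ termMnd S) (b : 𝟙 (termMnd T) ⟶ g ≫ f) (a : f ≫ g ⟶ 𝟙 (termMnd S))
    (h : Bicategory.rightZigzag b a =
      (Bicategory.rightUnitor f).hom ≫ (Bicategory.leftUnitor f).inv) (s : S.Srt) :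
    Finite (Σ t, AlgMorphism.L f |>.obj (Point s) t) := by
  let X : S.Srt → Type u := Point s
  let N : T.Srt → Type u := (AlgMorphism.L f).obj X
  let G : (T.Srt → Type u) ⥤ (S.Srt → Type u) := AlgMorphism.L g
  have h₁ : Bicategory.whiskerLeft f b ≫ (Bicategory.associator f g f).inv ≫
      Bicategory.whiskerRight a f =
        (Bicategory.rightUnitor f).hom ≫ (Bicategory.leftUnitor f).inv := by
    rw [← h]
    simp [Bicategory.rightZigzag, bicategoricalComp]
  -- The associator and the unitors have unit components and drop out, so the zigzag identity at
  -- `Point s` says that this Kleisli composite is the identity of `N` in the Kleisli category.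
  have h₂ : kleisli (N := termMnd T) (extend (M := termMnd S) f (AlgTransformation.app a X))
      (AlgTransformation.app b N) = (termMonad T).η.app N := by
    have h₃ := congrArg (fun ξ : AlgTransformation (AlgMorphism.comp f (AlgMorphism.id (termMnd T)))
      (AlgMorphism.comp (AlgMorphism.id (termMnd S)) f) => ξ.app X) h₁
    refine Eq.trans ?_ (h₃.trans (kleisli_unit (N := termMnd T) _))
    exact congrArg (fun k => kleisli (N := termMnd T) k (AlgTransformation.app b N))
      (kleisli_unit (N := termMnd T) _).symm
  -- The component of `a` at `Point s` is one single term, hence it has a finite support `A` in `N`.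
  obtain ⟨A, hA, Q, hQ⟩ := Term.exists_finite_support (S := S) (T := T.Srt) (L := G) (N := N)
    (AlgMorphism.adj g) (AlgTransformation.app a X s Point.mk)
  have ha : AlgTransformation.app a X = (Point.desc Q : X ⟶ (termMonad S).obj _) ≫
      (termMonad S).map (G.map (SortedSubset.incl A)) :=
    sorted_hom_ext fun s' y => by cases y; exact hQ.symm
  have h₄ : ∃ k : N ⟶ (termMonad T).obj (SortedSubset A),
      k ≫ (termMonad T).map (SortedSubset.incl A) = (termMonad T).η.app N := by
    rw [ha] at h₂
    exact ⟨_, (kleisli_extend_map (M := termMnd S) (N := termMnd T) f g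
      (AlgTransformation.app b) (AlgTransformation.nat b) _ _).symm.trans h₂⟩
  obtain ⟨k, hk⟩ := h₄
  refine Set.finite_univ_iff.1 (hA.subset ?_)
  rintro ⟨t, n⟩ -
  have hn : (k t n : Term T (SortedSubset A) t).rename (fun t m => SortedSubset.incl A t m) =
    Term.var n := congrArg (fun k : N ⟶ (termMonad T).obj N => k t n) hk
  revert hn
  -- Renaming preserves the outermost constructor. A term over `A` that becomes the variable `n` is
  -- therefore itself a variable, and so `n` lies in `A`.
  generalize (k t n : Term T (SortedSubset A) t) = R
  intro hn
  cases R with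
  | var m =>
    have : SortedSubset.incl A t m = n := Term.var.inj hn
    exact this ▸ m.2
  | op σ args => nomatch (show Term.op σ _ = Term.var n from hn)

/-- A finite sorted set is the sorted set of variables of a word. -/
theorem exists_word {T : Type u} (N : T → Type u) [Finite (Σ t, N t)] :
    ∃ w : List T, ∀ t, Nonempty (Var w t ≃ N t) := by
  obtain ⟨n, ⟨e⟩⟩ := Finite.exists_equiv_fin (Σ t, N t)
  -- The word lists the sorts of the elements in an enumeration of the total set, so its positions
  -- of sort `t` correspond to the elements of sort `t`.
  refine ⟨List.ofFn fun i => (e.symm i).1, fun t => ⟨(Var.equivPos _ t).trans ?_⟩⟩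
  refine (Equiv.subtypeEquiv (finCongr (List.length_ofFn ..)) fun i => ?_).trans
    ((e.symm.subtypeEquiv (p := fun i => (e.symm i).1 = t) (q := fun p => p.1 = t)
      fun _ => Iff.rfl).trans (Equiv.sigmaSubtype t))
  simp
  rfl

/-- An alg-morphism between term monads that satisfies a zigzag identity comes from a polyderivor. -/
theorem exists_termMor_iso_of_rightZigzag {S T : Signature.{u}} (f : termMnd S ⟶ termMnd T)
    (g : termMnd T ⟶ termMnd S) (b : 𝟙 (termMnd T) ⟶ g ≫ f) (a : f ≫ g ⟶ 𝟙 (termMnd S))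
    (h : Bicategory.rightZigzag b a =
      (Bicategory.rightUnitor f).hom ≫ (Bicategory.leftUnitor f).inv) :
    ∃ d : S ⟶ T, Nonempty (termPseudofunctor.map d ≅ f) := by
  have : ∀ s : S.Srt, ∃ w : List T.Srt,
      ∀ t, Nonempty (Var w t ≃ (AlgMorphism.L f).obj (Point s) t) := fun s =>
    have := finite_of_rightZigzag f g b a h s
    exists_word ((AlgMorphism.L f).obj (Point s))
  choose φ hφ using this
  exact exists_termMor_iso f φ
    (coprodFunctorIso (AlgMorphism.adj f) φ (fun s t => (hφ s t).some))

/-! ### Reflection of isomorphisms and equivalences -/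

/-- The pseudo-functor reflects isomorphisms of polyderivors. -/
theorem nonempty_iso_of_termPseudofunctor {S T : Signature.{u}} {d e : S ⟶ T}
    (i : termPseudofunctor.map d ≅ termPseudofunctor.map e) : Nonempty (d ≅ e) := by
  obtain ⟨ξ, hξ⟩ := (termTrans_bijective d e).2 i.hom
  obtain ⟨χ, hχ⟩ := (termTrans_bijective e d).2 i.inv
  -- The preimages are inverse to one another because injectivity on 2-cells reflects the two
  -- identities that hold between their images.
  refine ⟨⟨ξ, χ, (termTrans_bijective d d).1 ?_, (termTrans_bijective e e).1 ?_⟩⟩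
  · refine (termPseudofunctor.map₂_comp ξ χ).trans (Eq.trans ?_ (termPseudofunctor.map₂_id d).symm)
    refine Eq.trans ?_ i.hom_inv_id
    exact congrArg₂ (fun x y => x ≫ y) hξ hχ
  · refine (termPseudofunctor.map₂_comp χ ξ).trans (Eq.trans ?_ (termPseudofunctor.map₂_id e).symm)
    refine Eq.trans ?_ i.inv_hom_id
    exact congrArg₂ (fun x y => x ≫ y) hχ hξ

/-- Signatures with equivalent term monads are equivalent. -/
theorem nonempty_equivalence_of_termPseudofunctor {S T : Signature.{u}}
    (E : Bicategory.Equivalence (termPseudofunctor.obj S) (termPseudofunctor.obj T)) :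
    Nonempty (Bicategory.Equivalence S T) := by
  -- For `E.hom` the required zigzag is formed from the inverses of the counit and the unit, and it
  -- is the inverse of the left triangle. For `E.inv` the right triangle serves directly.
  have h : Bicategory.rightZigzag E.counit.inv E.unit.inv =
      (Bicategory.rightUnitor E.hom).hom ≫ (Bicategory.leftUnitor E.hom).inv := by
    rw [← Bicategory.leftZigzagIso_inv, E.left_triangle]
    rfl
  obtain ⟨d, ⟨i⟩⟩ := exists_termMor_iso_of_rightZigzag E.hom E.inv _ _ h
  obtain ⟨e, ⟨j⟩⟩ := exists_termMor_iso_of_rightZigzag E.inv E.hom _ _ E.right_triangle_hom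
  -- The unit of `E` is carried along `i` and `j` to an isomorphism between the images of `𝟙 S` and
  -- `d ≫ e`, which lifts. The counit is treated likewise.
  obtain ⟨η⟩ := nonempty_iso_of_termPseudofunctor (d := 𝟙 S) (e := d ≫ e)
    (termPseudofunctor.mapId S ≪≫ E.unit ≪≫ Bicategory.whiskerRightIso i.symm E.inv ≪≫
      Bicategory.whiskerLeftIso _ j.symm ≪≫ (termPseudofunctor.mapComp d e).symm)
  obtain ⟨ε⟩ := nonempty_iso_of_termPseudofunctor (d := e ≫ d) (e := 𝟙 T)
    (termPseudofunctor.mapComp e d ≪≫ Bicategory.whiskerRightIso j _ ≪≫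
      Bicategory.whiskerLeftIso _ i ≪≫ E.counit ≪≫ (termPseudofunctor.mapId T).symm)
  -- The isomorphisms `η` and `ε` were chosen independently and need not satisfy the triangle
  -- identity, so the counit is adjusted.
  exact ⟨Bicategory.Equivalence.mkOfAdjointifyCounit η ε⟩

/-- The equation with `termPrelax` fixes the values on objects, morphisms and 2-cells. Only the
comparison isomorphisms for identities and composites are left to be chosen. -/
theorem corollary20 :
    ∃ F : Pseudofunctor Signature.{u} MndAlg.{u, u + 1},
      F.toPrelaxFunctorStruct = termPrelax.{u} ∧
      (∀ (S T : Signature.{u}) (d e : S ⟶ T),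
        Function.Bijective (fun ξ : d ⟶ e => F.map₂ ξ)) ∧
      (∀ (S T : Signature.{u}) (d e : S ⟶ T),
        Nonempty (F.map d ≅ F.map e) → Nonempty (d ≅ e)) ∧
      (∀ S T : Signature.{u},
        Nonempty (Bicategory.Equivalence (F.obj S) (F.obj T)) →
          Nonempty (Bicategory.Equivalence S T)) := by
  exact ⟨termPseudofunctor, rfl, fun _ _ d e => termTrans_bijective d e,
    fun _ _ _ _ ⟨i⟩ => nonempty_iso_of_termPseudofunctor i,
    fun _ _ ⟨E⟩ => nonempty_equivalence_of_termPseudofunctor E⟩
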